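/- Let $k$ be a field and let $H=(H,\Delta,\varepsilon,\phi,S,\alpha,\beta)$ be a quasi-Hopf algebra over $k$ (not necessarily finite-dimensional) whose antipode $S$ is bijective. That is: $H$ is an associative unital $k$-algebra, $\Delta:H\to H\otimes H$ and $\varepsilon:H\to k$ are algebra maps, $\phi\in H^{\otimes 3}$ is invertible, $S:H\to H$ is an anti-algebra map, $\alpha,\beta\in H$, and for all $h\in H$ (with sums suppressed, $\Delta(h)=h_{(1)}\otimes h_{(2)}$, $\phi=\phi_1\otimes\phi_2\otimes\phi_3$, $\phi^{-1}=\bar\phi_1\otimes\bar\phi_2\otimes\bar\phi_3$) $$h_{(1)}\otimes\Delta(h_{(2)})=\phi\,(\Delta(h_{(1)})\otimes h_{(2)})\,\phi^{-1},\qquad \varepsilon(h_{(1)})h_{(2)}=h=h_{(1)}\varepsilon(h_{(2)}),$$ $$(\mathrm{id}\otimes\mathrm{id}\otimes\Delta)(\phi)\,(\Delta\otimes\mathrm{id}\otimes\mathrm{id})(\phi)=(1\otimes\phi)\,(\mathrm{id}\otimes\Delta\otimes\mathrm{id})(\phi)\,(\phi\otimes1),\qquad(\mathrm{id}\otimes\varepsilon\otimes\mathrm{id})(\phi)=1\otimes1,$$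 $$S(h_{(1)})\alpha h_{(2)}=\varepsilon(h)\alpha,\quad h_{(1)}\beta S(h_{(2)})=\varepsilon(h)\beta,\quad \phi_1\beta S(\phi_2)\alpha\phi_3=1=S(\bar\phi_1)\alpha\bar\phi_2\beta S(\bar\phi_3),$$ normalized by $\varepsilon(\alpha)=\varepsilon(\beta)=1$. We write $\Delta(h_{(1)})\otimes h_{(2)}=h_{(1,1)}\otimes h_{(1,2)}\otimes h_{(2)}$. Let $q=S(\bar\phi_1)\alpha\bar\phi_2\otimes\bar\phi_3$, let $b=\phi_{1(1)}\bar\phi_1\beta S(\phi_3)\otimes\phi_{1(2)}\bar\phi_2\beta S(\phi_2\bar\phi_3)$, and let $$f^{-1}=\bar f_1\otimes\bar f_2=\Delta(q_1)\,b\,\bigl(S(q_{2(2)})\otimes S(q_{2(1)})\bigr)\in H\otimes H$$ (the inverse of Drinfeld's gauge transformation). Let $\chi=(\phi\otimes1)(\Delta\otimes\mathrm{id}\otimes\mathrm{id})(\phi^{-1})\in H^{\otimes4}$ and $$\omega=(1\otimes1\otimes1\otimes\bar f_2\otimes\bar f_1)\,(\mathrm{id}\otimes\Delta\otimes S\otimes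 S)(\chi)\,(\phi\otimes1\otimes1)\in H^{\otimes5}.$$ A Yetter–Drinfeld $H$-module (of the second kind) is a left $H$-module $V$ with a linear map $\delta:V\to H\otimes V$, $\delta(v)=v_{[-1]}\otimes v_{[0]}$, such that for all $h\in H$, $v\in V$ $$v_{[-1]}\otimes \delta(v_{[0]})=\omega_1(v_{[-1]})_{(1)}\omega_5\otimes\omega_2(v_{[-1]})_{(2)}\omega_4\otimes\omega_3v_{[0]},$$ $$\varepsilon(v_{[-1]})v_{[0]}=v,\qquad \delta(hv)=h_{(1,1)}v_{[-1]}S(h_{(2)})\otimes h_{(1,2)}v_{[0]};$$ its endomorphism algebra consists of the $H$-linear maps $g:V\to V$ with $\delta g=(\mathrm{id}\otimes g)\delta$, under composition. For a left $H$-module $V$ let $R(V)=H\otimes V$ with $$h\triangleright(a\otimes v)=h_{(1,1)}aS(h_{(2)})\otimes h_{(1,2)}v,\qquad \delta(a\otimes v)=\omega_1a_{(1)}\omega_5\otimes\omega_2a_{(2)}\omega_4\otimes\omega_3v,$$ and let $\mathbf A=R(\mathbb 1)$, where $\mathbb 1=k$ is the trivial module (via $\varepsilon$), with $H\otimes k$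 identified with $H$. Let $\mathsf{CF}(H)=\mathrm{Hom}_H(\mathbf A,\mathbb 1)\subseteq H^*$ be the space of class functions. **Theorem.** $\mathbf A$ is a Yetter–Drinfeld $H$-module. The vector space $\mathsf{CF}(H)$ is closed under, and is an associative unital $k$-algebra with respect to, the multiplication $\star$ given by $$\langle\xi\star\zeta,a\rangle=\langle\xi,\phi_1\bar\phi_{1(1)}a_{(1)}\bar f_1S(\bar\phi_3)\rangle\,\langle\zeta,\phi_2\bar\phi_{1(2)}a_{(2)}\bar f_2S(\phi_3\bar\phi_2)\rangle\qquad(\xi,\zeta\in\mathsf{CF}(H),\ a\in\mathbf A),$$ and $\xi\star\zeta=(\xi\otimes\zeta)\circ\delta_{\mathbf A}$, where $\delta_{\mathbf A}$ is the coaction of $\mathbf A$. The algebra $\mathsf{CF}(H)$ is isomorphic, as a unital $k$-algebra, to the endomorphism algebra of the Yetter–Drinfeld $H$-module $\mathbf A$. -/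

import Mathlib

open scoped TensorProduct

noncomputable section

universe u v w

/-! Tensor powers of `H` are right nested: `H ⊗ (H ⊗ (H ⊗ H))`, and so on. -/

/-- The linear map underlying an anti-algebra map `S : H → H`. -/
def antiLin {k : Type u} {H : Type v} [Field k] [Ring H] [Algebra k H]
    (S : H →ₐ[k] Hᵐᵒᵖ) : H →ₗ[k] H :=
  (MulOpposite.opLinearEquiv k).symm.toLinearMap ∘ₗ S.toLinearMap

@[simp]
theorem antiLin_apply {k : Type u} {H : Type v} [Field k] [Ring H] [Algebra k H]
    (S : H →ₐ[k] Hᵐᵒᵖ) (h : H) : antiLin S h = (S h).unop := rfl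

/-- The linear map `x ⊗ y ↦ S(x) α y`. -/
def antiLeft {k : Type u} {H : Type v} [Field k] [Ring H] [Algebra k H]
    (S : H →ₐ[k] Hᵐᵒᵖ) (α : H) : H ⊗[k] H →ₗ[k] H :=
  LinearMap.mul' k H ∘ₗ
    TensorProduct.map (LinearMap.mulRight k α ∘ₗ antiLin S) LinearMap.id

@[simp]
theorem antiLeft_tmul {k : Type u} {H : Type v} [Field k] [Ring H] [Algebra k H]
    (S : H →ₐ[k] Hᵐᵒᵖ) (α x y : H) :
    antiLeft S α (x ⊗ₜ[k] y) = (S x).unop * α * y := rfl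

/-- The linear map `x ⊗ y ↦ x β S(y)`. -/
def antiRight {k : Type u} {H : Type v} [Field k] [Ring H] [Algebra k H]
    (S : H →ₐ[k] Hᵐᵒᵖ) (β : H) : H ⊗[k] H →ₗ[k] H :=
  LinearMap.mul' k H ∘ₗ TensorProduct.map (LinearMap.mulRight k β) (antiLin S)

@[simp]
theorem antiRight_tmul {k : Type u} {H : Type v} [Field k] [Ring H] [Algebra k H]
    (S : H →ₐ[k] Hᵐᵒᵖ) (β x y : H) :
    antiRight S β (x ⊗ₜ[k] y) = x * β * (S y).unop := rfl

/-- `Δ ⊗ id : H ⊗ M → H ⊗ (H ⊗ M)` (with the brackets moved to the right) for a linear map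
`Δ : H → H ⊗ H`. -/
def comulFst {k : Type u} {H : Type v} [Field k] [Ring H] [Algebra k H]
    (Δ : H →ₐ[k] H ⊗[k] H) (M : Type w) [AddCommGroup M] [Module k M] :
    H ⊗[k] M →ₗ[k] H ⊗[k] (H ⊗[k] M) :=
  (TensorProduct.assoc k H H M).toLinearMap ∘ₗ TensorProduct.map Δ.toLinearMap LinearMap.id

/-- A quasi-Hopf algebra structure `(Δ, ε, φ, S, α, β)` on the `k`-algebra `H`, normalized by
`ε(α) = ε(β) = 1`. The anti-algebra map `S` is an algebra map to the opposite algebra. -/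
structure QuasiHopfAlgebra (k : Type u) (H : Type v) [Field k] [Ring H] [Algebra k H] where
  comul : H →ₐ[k] H ⊗[k] H
  counit : H →ₐ[k] k
  phi : (H ⊗[k] (H ⊗[k] H))ˣ
  antipode : H →ₐ[k] Hᵐᵒᵖ
  alpha : H
  beta : H
  /-- `h₍₁₎ ⊗ Δ(h₍₂₎) = φ · (Δ(h₍₁₎) ⊗ h₍₂₎) · φ⁻¹` -/
  coassoc : ∀ h : H,
    TensorProduct.map LinearMap.id comul.toLinearMap (comul h) =
      (phi : H ⊗[k] (H ⊗[k] H)) * comulFst comul H (comul h) *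
        ((phi⁻¹ : (H ⊗[k] (H ⊗[k] H))ˣ) : H ⊗[k] (H ⊗[k] H))
  /-- `ε(h₍₁₎) h₍₂₎ = h` -/
  counit_left : ∀ h : H,
    TensorProduct.lid k H (TensorProduct.map counit.toLinearMap LinearMap.id (comul h)) = h
  /-- `h₍₁₎ ε(h₍₂₎) = h` -/
  counit_right : ∀ h : H,
    TensorProduct.rid k H (TensorProduct.map LinearMap.id counit.toLinearMap (comul h)) = h
  /-- `(id ⊗ id ⊗ Δ)(φ) (Δ ⊗ id ⊗ id)(φ) = (1 ⊗ φ) (id ⊗ Δ ⊗ id)(φ) (φ ⊗ 1)` -/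
  pentagon :
    TensorProduct.map LinearMap.id (TensorProduct.map LinearMap.id comul.toLinearMap)
        (phi : H ⊗[k] (H ⊗[k] H)) *
      comulFst comul (H ⊗[k] H) (phi : H ⊗[k] (H ⊗[k] H)) =
    (1 : H) ⊗ₜ[k] (phi : H ⊗[k] (H ⊗[k] H)) *
      TensorProduct.map LinearMap.id (comulFst comul H) (phi : H ⊗[k] (H ⊗[k] H)) *
      TensorProduct.map LinearMap.id
        (TensorProduct.map LinearMap.id ((TensorProduct.mk k H H).flip 1))
        (phi : H ⊗[k] (H ⊗[k] H))
  /-- `(id ⊗ ε ⊗ id)(φ) = 1 ⊗ 1` -/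
  counit_phi :
    TensorProduct.map LinearMap.id
        ((TensorProduct.lid k H).toLinearMap ∘ₗ
          TensorProduct.map counit.toLinearMap LinearMap.id)
        (phi : H ⊗[k] (H ⊗[k] H)) = (1 : H ⊗[k] H)
  /-- `S(h₍₁₎) α h₍₂₎ = ε(h) α` -/
  antipode_alpha : ∀ h : H, antiLeft antipode alpha (comul h) = counit h • alpha
  /-- `h₍₁₎ β S(h₍₂₎) = ε(h) β` -/
  antipode_beta : ∀ h : H, antiRight antipode beta (comul h) = counit h • beta
  /-- `φ₁ β S(φ₂) α φ₃ = 1` -/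
  phi_antipode :
    (LinearMap.mul' k H ∘ₗ
        TensorProduct.map (LinearMap.mulRight k beta) (antiLeft antipode alpha))
      (phi : H ⊗[k] (H ⊗[k] H)) = 1
  /-- `S(φ̄₁) α φ̄₂ β S(φ̄₃) = 1`, where `φ⁻¹ = φ̄₁ ⊗ φ̄₂ ⊗ φ̄₃` -/
  phiInv_antipode :
    (LinearMap.mul' k H ∘ₗ
        TensorProduct.map (LinearMap.mulRight k alpha ∘ₗ antiLin antipode)
          (antiRight antipode beta))
      ((phi⁻¹ : (H ⊗[k] (H ⊗[k] H))ˣ) : H ⊗[k] (H ⊗[k] H)) = 1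
  counit_alpha : counit alpha = 1
  counit_beta : counit beta = 1

/-- The permutation `x ⊗ y ⊗ z ⊗ w ↦ (x ⊗ w) ⊗ (y ⊗ z)`. -/
def outerInner (k : Type u) (H : Type v) [Field k] [Ring H] [Algebra k H] :
    H ⊗[k] (H ⊗[k] (H ⊗[k] H)) ≃ₗ[k] (H ⊗[k] H) ⊗[k] (H ⊗[k] H) :=
  (TensorProduct.congr (LinearEquiv.refl k H)
      ((TensorProduct.assoc k H H H).symm.trans (TensorProduct.comm k (H ⊗[k] H) H))).trans
    (TensorProduct.assoc k H H (H ⊗[k] H)).symm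

@[simp]
theorem outerInner_tmul (k : Type u) (H : Type v) [Field k] [Ring H] [Algebra k H]
    (x y z w : H) :
    outerInner k H (x ⊗ₜ (y ⊗ₜ (z ⊗ₜ w))) = (x ⊗ₜ w) ⊗ₜ (y ⊗ₜ z) := rfl

/-- The permutation `a ⊗ b ⊗ c ⊗ d ⊗ e ↦ (a ⊗ e) ⊗ ((b ⊗ d) ⊗ c)`. -/
def nestFive (k : Type u) (H : Type v) [Field k] [Ring H] [Algebra k H] :
    H ⊗[k] (H ⊗[k] (H ⊗[k] (H ⊗[k] H))) ≃ₗ[k]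
      (H ⊗[k] H) ⊗[k] ((H ⊗[k] H) ⊗[k] H) :=
  (TensorProduct.congr (LinearEquiv.refl k H)
      ((TensorProduct.congr (LinearEquiv.refl k H)
          ((TensorProduct.assoc k H H H).symm.trans
            (TensorProduct.congr (TensorProduct.comm k H H) (LinearEquiv.refl k H)))).trans
        ((TensorProduct.congr (LinearEquiv.refl k H) (TensorProduct.assoc k H H H)).trans
          ((TensorProduct.assoc k H H (H ⊗[k] H)).symm.trans
            ((TensorProduct.assoc k (H ⊗[k] H) H H).symm.trans
              (TensorProduct.comm k ((H ⊗[k] H) ⊗[k] H) H)))))).trans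
    (TensorProduct.assoc k H H ((H ⊗[k] H) ⊗[k] H)).symm

@[simp]
theorem nestFive_tmul (k : Type u) (H : Type v) [Field k] [Ring H] [Algebra k H]
    (a b c d e : H) :
    nestFive k H (a ⊗ₜ (b ⊗ₜ (c ⊗ₜ (d ⊗ₜ e)))) = (a ⊗ₜ e) ⊗ₜ ((b ⊗ₜ d) ⊗ₜ c) := rfl

/-- The linear map sending `x ⊗ y` to the operator `m ↦ x m y` on `H`. -/
def sandwich (k : Type u) (H : Type v) [Field k] [Ring H] [Algebra k H] :
    H ⊗[k] H →ₗ[k] Module.End k H :=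
  (AlgHom.mulLeftRight k H).toLinearMap ∘ₗ
    TensorProduct.map LinearMap.id (MulOpposite.opLinearEquiv k).toLinearMap

@[simp]
theorem sandwich_tmul_apply (k : Type u) (H : Type v) [Field k] [Ring H] [Algebra k H]
    (x y m : H) : sandwich k H (x ⊗ₜ y) m = x * m * y := by
  simp [sandwich]

/-- A left `H`-module structure on the `k`-vector space `V`. -/
abbrev LeftAction (k : Type u) (H : Type v) [Field k] [Ring H] [Algebra k H]
    (V : Type w) [AddCommGroup V] [Module k V] : Type (max v w) :=
  H →ₐ[k] Module.End k V

/-- The space `Hom_H(V, W)` of `H`-linear maps. -/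
def homH {k : Type u} {H : Type v} [Field k] [Ring H] [Algebra k H]
    {V : Type*} [AddCommGroup V] [Module k V] {W : Type*} [AddCommGroup W] [Module k W]
    (ρ : LeftAction k H V) (σ : LeftAction k H W) : Submodule k (V →ₗ[k] W) where
  carrier := {f | ∀ (h : H) (x : V), f (ρ h x) = σ h (f x)}
  add_mem' := by
    intro f g hf hg h x
    simp only [LinearMap.add_apply, map_add, hf h x, hg h x]
  zero_mem' := by
    intro h x
    simp
  smul_mem' := by
    intro c f hf h x
    simp only [LinearMap.smul_apply, map_smul, hf h x]

namespace QuasiHopfAlgebra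

variable {k : Type u} {H : Type v} [Field k] [Ring H] [Algebra k H]

/-- `φ⁻¹` as an element of `H ⊗ H ⊗ H`. -/
def phiInv (Q : QuasiHopfAlgebra k H) : H ⊗[k] (H ⊗[k] H) :=
  ((Q.phi⁻¹ : (H ⊗[k] (H ⊗[k] H))ˣ) : H ⊗[k] (H ⊗[k] H))

/-- The antipode as a linear map `H → H`. -/
def S (Q : QuasiHopfAlgebra k H) : H →ₗ[k] H := antiLin Q.antipode

/-- `qᴸ = S(φ̄₁) α φ̄₂ ⊗ φ̄₃`. -/
def qL (Q : QuasiHopfAlgebra k H) : H ⊗[k] H :=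
  TensorProduct.map (antiLeft Q.antipode Q.alpha) LinearMap.id
    ((TensorProduct.assoc k H H H).symm Q.phiInv)

/-- The element `x ⊗ 1` of `H^{⊗4}` for `x` in `H^{⊗3}`. -/
def tensorOne (x : H ⊗[k] (H ⊗[k] H)) : H ⊗[k] (H ⊗[k] (H ⊗[k] H)) :=
  TensorProduct.map LinearMap.id
    (TensorProduct.map LinearMap.id ((TensorProduct.mk k H H).flip 1)) x

/-- The element `b = φ₁₍₁₎ φ̄₁ β S(φ₃) ⊗ φ₁₍₂₎ φ̄₂ β S(φ₂ φ̄₃)`, obtained from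
`(Δ ⊗ id ⊗ id)(φ) (φ⁻¹ ⊗ 1)` by applying `x ⊗ y ⊗ z ⊗ w ↦ x β S(w) ⊗ y β S(z)`. -/
def twistB (Q : QuasiHopfAlgebra k H) : H ⊗[k] H :=
  TensorProduct.map (antiRight Q.antipode Q.beta) (antiRight Q.antipode Q.beta)
    (outerInner k H
      (comulFst Q.comul (H ⊗[k] H) (Q.phi : H ⊗[k] (H ⊗[k] H)) * tensorOne Q.phiInv))

/-- `(S ⊗ S) ∘ Δᶜᵒᵖ`, that is `h ↦ S(h₍₂₎) ⊗ S(h₍₁₎)`. -/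
def antipodeCop (Q : QuasiHopfAlgebra k H) : H →ₗ[k] H ⊗[k] H :=
  TensorProduct.map Q.S Q.S ∘ₗ (TensorProduct.comm k H H).toLinearMap ∘ₗ Q.comul.toLinearMap

/-- The inverse `f⁻¹ = Δ(qᴸ₁) b (S ⊗ S)(Δᶜᵒᵖ(qᴸ₂))` of the Drinfeld gauge transformation `f`. -/
def twistInv (Q : QuasiHopfAlgebra k H) : H ⊗[k] H :=
  (LinearMap.mul' k (H ⊗[k] H) ∘ₗ
    TensorProduct.map (LinearMap.mulRight k Q.twistB ∘ₗ Q.comul.toLinearMap) Q.antipodeCop) Q.qL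

/-- `χ = (φ ⊗ 1) (Δ ⊗ id ⊗ id)(φ⁻¹)`, an element of `H^{⊗4}`. -/
def chi (Q : QuasiHopfAlgebra k H) : H ⊗[k] (H ⊗[k] (H ⊗[k] H)) :=
  tensorOne (Q.phi : H ⊗[k] (H ⊗[k] H)) * comulFst Q.comul (H ⊗[k] H) Q.phiInv

set_option maxSynthPendingDepth 6 in
/-- `ω = (1 ⊗ 1 ⊗ 1 ⊗ f̄₂ ⊗ f̄₁) · (id ⊗ Δ ⊗ S ⊗ S)(χ) · (φ ⊗ 1 ⊗ 1)`, an element of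
`H^{⊗5}`. -/
def omega (Q : QuasiHopfAlgebra k H) : H ⊗[k] (H ⊗[k] (H ⊗[k] (H ⊗[k] H))) :=
  (1 : H) ⊗ₜ[k] ((1 : H) ⊗ₜ[k] ((1 : H) ⊗ₜ[k] (TensorProduct.comm k H H Q.twistInv))) *
    TensorProduct.map LinearMap.id
      (comulFst Q.comul (H ⊗[k] H) ∘ₗ
        TensorProduct.map LinearMap.id (TensorProduct.map Q.S Q.S)) Q.chi *
    TensorProduct.map LinearMap.id
      (TensorProduct.map LinearMap.id ((TensorProduct.mk k H (H ⊗[k] H)).flip 1))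
      (Q.phi : H ⊗[k] (H ⊗[k] H))

variable {V : Type w} [AddCommGroup V] [Module k V]

/-- The action of `H` on `R(V) = H ⊗ V`, given by
`h ▷ (a ⊗ v) = h₍₁,₁₎ a S(h₍₂₎) ⊗ h₍₁,₂₎ v`. -/
def inducedAction (Q : QuasiHopfAlgebra k H) (ρ : LeftAction k H V) :
    LeftAction k H (H ⊗[k] V) :=
  (Module.endTensorEndAlgHom (R := k) (S := k) (A := k) (M := H) (N := V)).comp
    ((Algebra.TensorProduct.map (AlgHom.mulLeftRight k H) ρ).comp
      (AlgHom.comp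
        ((Algebra.TensorProduct.assoc k k k H Hᵐᵒᵖ H).symm.toAlgHom.comp
          ((Algebra.TensorProduct.congr AlgEquiv.refl
            (Algebra.TensorProduct.comm k H Hᵐᵒᵖ)).toAlgHom.comp
            (Algebra.TensorProduct.assoc k k k H H Hᵐᵒᵖ).toAlgHom))
        ((Algebra.TensorProduct.map Q.comul Q.antipode).comp Q.comul)))

/-- The linear map `H ⊗ (H ⊗ V) → H ⊗ (H ⊗ V)`,
`m ⊗ n ⊗ v ↦ ω₁ m ω₅ ⊗ ω₂ n ω₄ ⊗ ω₃ v`. -/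
def Omega (Q : QuasiHopfAlgebra k H) (ρ : LeftAction k H V) :
    H ⊗[k] (H ⊗[k] V) →ₗ[k] H ⊗[k] (H ⊗[k] V) :=
  (TensorProduct.homTensorHomMap (RingHom.id k) H (H ⊗[k] V) H (H ⊗[k] V) ∘ₗ
    TensorProduct.map (sandwich k H)
      (TensorProduct.homTensorHomMap (RingHom.id k) H V H V ∘ₗ
        TensorProduct.map (sandwich k H) ρ.toLinearMap)) (nestFive k H Q.omega)

/-- Yetter-Drinfeld modules (of the second kind): the left `H`-module `(V, ρ)` with the linear
map `δ : V → H ⊗ V`, written `v ↦ v₋₁ ⊗ v₀`, is a Yetter-Drinfeld `H`-module. -/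
structure IsYetterDrinfeld (Q : QuasiHopfAlgebra k H) (ρ : LeftAction k H V)
    (δ : V →ₗ[k] H ⊗[k] V) : Prop where
  /-- `v₋₁ ⊗ v₀,₋₁ ⊗ v₀,₀ = ω₁ (v₋₁)₍₁₎ ω₅ ⊗ ω₂ (v₋₁)₍₂₎ ω₄ ⊗ ω₃ v₀` -/
  coassoc : ∀ v : V,
    TensorProduct.map LinearMap.id δ (δ v) = Q.Omega ρ (comulFst Q.comul V (δ v))
  /-- `ε(v₋₁) v₀ = v` -/
  counit : ∀ v : V,
    TensorProduct.lid k V (TensorProduct.map Q.counit.toLinearMap LinearMap.id (δ v)) = v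
  /-- `δ(h v) = h₍₁,₁₎ v₋₁ S(h₍₂₎) ⊗ h₍₁,₂₎ v₀` -/
  equivariant : ∀ (h : H) (v : V), δ (ρ h v) = Q.inducedAction ρ h (δ v)

/-- The endomorphism algebra of the Yetter-Drinfeld module `(V, ρ, δ)`: the linear
endomorphisms that preserve the action and the coaction, with composition as product. -/
def endYD (ρ : LeftAction k H V) (δ : V →ₗ[k] H ⊗[k] V) :
    Subalgebra k (Module.End k V) where
  carrier := {f | (∀ (h : H) (v : V), f (ρ h v) = ρ h (f v)) ∧
    ∀ v : V, δ (f v) = TensorProduct.map LinearMap.id f (δ v)}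
  mul_mem' := by
    rintro f g ⟨hf, hf'⟩ ⟨hg, hg'⟩
    refine ⟨fun h v => ?_, fun v => ?_⟩
    · simp only [Module.End.mul_apply, hg, hf]
    · simp only [Module.End.mul_apply, hf', hg']
      rw [← LinearMap.comp_apply, ← TensorProduct.map_comp]
      rfl
  add_mem' := by
    rintro f g ⟨hf, hf'⟩ ⟨hg, hg'⟩
    refine ⟨fun h v => ?_, fun v => ?_⟩
    · simp only [LinearMap.add_apply, hg, hf, map_add]
    · simp only [LinearMap.add_apply, map_add, hf', hg', TensorProduct.map_add_right]
  algebraMap_mem' := by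
    intro c
    refine ⟨fun h v => ?_, fun v => ?_⟩
    · simp [Module.algebraMap_end_apply]
    · have e : (algebraMap k (Module.End k V)) c = c • LinearMap.id := by
        ext x
        simp [Module.algebraMap_end_apply]
      rw [e, TensorProduct.map_smul_right, TensorProduct.map_id]
      simp

/-- The coaction `δ(a ⊗ v) = ω₁ a₍₁₎ ω₅ ⊗ ω₂ a₍₂₎ ω₄ ⊗ ω₃ v` of `H` on `R(V) = H ⊗ V`. -/
def inducedCoaction (Q : QuasiHopfAlgebra k H) (ρ : LeftAction k H V) :
    H ⊗[k] V →ₗ[k] H ⊗[k] (H ⊗[k] V) :=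
  Q.Omega ρ ∘ₗ comulFst Q.comul V

/-- The trivial `H`-module `𝟙 = k`. -/
def trivialAction (Q : QuasiHopfAlgebra k H) : LeftAction k H k :=
  (Algebra.lmul k k).comp Q.counit

/-- The action of `H` on `A = R(𝟙)`, where `R(𝟙) = H ⊗ k` is identified with `H`. -/
def adAction (Q : QuasiHopfAlgebra k H) : LeftAction k H H :=
  ((TensorProduct.rid k H).conjAlgEquiv k).toAlgHom.comp (Q.inducedAction Q.trivialAction)

/-- The coaction of `H` on `A = R(𝟙)`, where `R(𝟙) = H ⊗ k` is identified with `H`. -/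
def adCoaction (Q : QuasiHopfAlgebra k H) : H →ₗ[k] H ⊗[k] H :=
  TensorProduct.map LinearMap.id (TensorProduct.rid k H).toLinearMap ∘ₗ
    Q.inducedCoaction Q.trivialAction ∘ₗ (TensorProduct.rid k H).symm.toLinearMap

/-- The space `CF(H) = Hom_H(A, 𝟙)` of class functions. -/
def classFunctions (Q : QuasiHopfAlgebra k H) : Submodule k (H →ₗ[k] k) :=
  homH Q.adAction Q.trivialAction

/-- The linear map sending `a` to the element
`φ₁ φ̄₁₍₁₎ a₍₁₎ f̄₁ S(φ̄₃) ⊗ φ₂ φ̄₁₍₂₎ a₍₂₎ f̄₂ S(φ₃ φ̄₂)` of `H ⊗ H`: each term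
`x ⊗ y ⊗ z ⊗ w` of `(φ ⊗ 1) (Δ ⊗ id ⊗ id)(φ⁻¹)` acts on `Δ(a) f⁻¹` by
`m ⊗ n ↦ x m S(w) ⊗ y n S(z)`. -/
def starElement (Q : QuasiHopfAlgebra k H) : H →ₗ[k] H ⊗[k] H :=
  (TensorProduct.homTensorHomMap (RingHom.id k) H H H H ∘ₗ
      TensorProduct.map (sandwich k H ∘ₗ TensorProduct.map LinearMap.id Q.S)
        (sandwich k H ∘ₗ TensorProduct.map LinearMap.id Q.S))
    (outerInner k H
      (tensorOne (Q.phi : H ⊗[k] (H ⊗[k] H)) * comulFst Q.comul (H ⊗[k] H) Q.phiInv)) ∘ₗ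
  LinearMap.mulRight k Q.twistInv ∘ₗ Q.comul.toLinearMap

/-- The product `⟨ξ ⋆ ζ, a⟩ =
⟨ξ, φ₁ φ̄₁₍₁₎ a₍₁₎ f̄₁ S(φ̄₃)⟩ ⟨ζ, φ₂ φ̄₁₍₂₎ a₍₂₎ f̄₂ S(φ₃ φ̄₂)⟩` of linear forms on `H`. -/
def starProduct (Q : QuasiHopfAlgebra k H) (ξ ζ : H →ₗ[k] k) : H →ₗ[k] k :=
  LinearMap.mul' k k ∘ₗ TensorProduct.map ξ ζ ∘ₗ Q.starElement

end QuasiHopfAlgebra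

end

open scoped TensorProduct

noncomputable section

universe u v w

/-! For a class function `ξ` put `E(ξ) = (id ⊗ ξ)δ`, which is `coactEnd`. Equivariance of `δ` makes
`E(ξ)` `H`-linear. Coassociativity of `δ` makes it colinear, because the third leg of `ω` becomes
trivial once it meets an invariant form (`map_pairRight_Omega`). Conversely, for colinear `g`, `E(ε
∘ g) = E(ε) g = g` by `(id ⊗ ε)δ = id`, while `ε ∘ E(ξ) = ξ` by `(ε ⊗ id)δ = id`. Since `(ξ ⊗ ζ)δ =
ξ ∘ E(ζ)`, the map `E` turns `⋆` into composition, and associativity is inherited.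

The labour lies in proving that `A` is a Yetter–Drinfeld module. Elements of tensor powers are
handled through their images in an algebra `B`: the legs are algebra maps `H → B` with commuting
images, `Δ` becomes convolution `cv`, and `φ` becomes a unit `ph`. Quasi-coassociativity is then
conjugation by `ph`, and the pentagon is an equation in a group. Left multiplication and right
multiplication by `S(x)` are both algebra maps into `Module.End k B`, so antipodes are just further
legs.

The element `theta` is the image of `χ⁻¹`; its coherence `theta_coherence` follows from pentagons
and conjugations. The twist `f⁻¹` satisfies `Δ(S h) v = v (S ⊗ S)Δᶜᵒᵖ(h)` and `Δ(β) v = b`, and is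
determined by these two properties (`gauge_unique`). As `b` is `theta` applied to `β ⊗ β`, the
compatibility of `f⁻¹` with `φ` (`tw_coherence`) reduces to `theta_coherence` evaluated at `β ⊗ β ⊗
β`.

Finally `δ(a)` is `χ` acting on `Δ(a) f⁻¹`. Coassociativity combines `tw_coherence` with a second
use of `theta_coherence`; equivariance follows from `theta_semiconj` and the antipode property of
`f⁻¹`. -/

namespace QuasiHopfAlgebra

/-! ### Calculus of commuting algebra maps: convolution, images of `φ`, pentagon. -/

section Calculus

variable {k : Type u} {H : Type v} [Field k] [Ring H] [Algebra k H]
variable {B : Type*} [Ring B] [Algebra k B]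
variable {M : Type*} [AddCommGroup M] [Module k M]

/-- Two algebra maps with commuting images. -/
def Com (f g : H →ₐ[k] B) : Prop := ∀ x y, Commute (f x) (g y)

theorem Com.symm {f g : H →ₐ[k] B} (h : Com f g) : Com g f := fun x y => (h y x).symm

/-- The linear map `x ⊗ m ↦ f(x) L(m)`. -/
def mulMap (f : H →ₐ[k] B) (L : M →ₗ[k] B) : H ⊗[k] M →ₗ[k] B :=
  LinearMap.mul' k B ∘ₗ TensorProduct.map f.toLinearMap L

@[simp]
theorem mulMap_tmul (f : H →ₐ[k] B) (L : M →ₗ[k] B) (x : H) (m : M) :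
    mulMap f L (x ⊗ₜ m) = f x * L m := rfl

theorem mulMap_map {N : Type*} [AddCommGroup N] [Module k N] (f : H →ₐ[k] B) (L : M →ₗ[k] B)
    (g : N →ₗ[k] M) (t : H ⊗[k] N) :
    mulMap f L (TensorProduct.map LinearMap.id g t) = mulMap f (L ∘ₗ g) t := by
  induction t with
  | zero => simp
  | tmul x y => simp
  | add x y hx hy => simp only [map_add, hx, hy]

/-- Induction step for the multiplicativity of `ev2`, `ev3` and `ev4`: commutation moves the second
`f`-factor past the first `L`-factor. -/
theorem mulMap_mul {A : Type*} [Ring A] [Algebra k A] (f : H →ₐ[k] B) (L : A →ₗ[k] B)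
    (hL : ∀ m n, L (m * n) = L m * L n) (hc : ∀ x m, Commute (f x) (L m)) (s t : H ⊗[k] A) :
    mulMap f L (s * t) = mulMap f L s * mulMap f L t := by
  induction s with
  | zero => simp
  | add x y hx hy => simp only [add_mul, map_add, hx, hy]
  | tmul x m =>
    induction t with
    | zero => simp
    | add x y hx hy => simp only [mul_add, map_add, hx, hy]
    | tmul y n =>
      simp only [Algebra.TensorProduct.tmul_mul_tmul, mulMap_tmul, map_mul, hL]
      rw [mul_assoc, ← mul_assoc (f y), (hc y m).eq, mul_assoc, mul_assoc]

theorem commute_mulMap {f : H →ₐ[k] B} {L : M →ₗ[k] B} {b : B} (hf : ∀ x, Commute b (f x))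
    (hL : ∀ m, Commute b (L m)) (t : H ⊗[k] M) : Commute b (mulMap f L t) := by
  induction t with
  | zero => simp
  | add x y hx hy => simpa only [map_add] using hx.add_right hy
  | tmul x m => exact (hf x).mul_right (hL m)

/-- The linear map `x ⊗ y ↦ f(x) g(y)`. -/
def ev2 (f g : H →ₐ[k] B) : H ⊗[k] H →ₗ[k] B := mulMap f g.toLinearMap

/-- The linear map `x ⊗ y ⊗ z ↦ f(x) g(y) h(z)`. -/
def ev3 (f g h : H →ₐ[k] B) : H ⊗[k] (H ⊗[k] H) →ₗ[k] B := mulMap f (ev2 g h)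

/-- The linear map `x ⊗ y ⊗ z ⊗ w ↦ f(x) g(y) h(z) i(w)`. -/
def ev4 (f g h i : H →ₐ[k] B) : H ⊗[k] (H ⊗[k] (H ⊗[k] H)) →ₗ[k] B := mulMap f (ev3 g h i)

@[simp]
theorem ev2_tmul (f g : H →ₐ[k] B) (x y : H) : ev2 f g (x ⊗ₜ y) = f x * g y := rfl

@[simp]
theorem ev3_tmul (f g h : H →ₐ[k] B) (x : H) (t : H ⊗[k] H) :
    ev3 f g h (x ⊗ₜ t) = f x * ev2 g h t := rfl

@[simp]
theorem ev4_tmul (f g h i : H →ₐ[k] B) (x : H) (t : H ⊗[k] (H ⊗[k] H)) :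
    ev4 f g h i (x ⊗ₜ t) = f x * ev3 g h i t := rfl

theorem ev2_mul {f g : H →ₐ[k] B} (hfg : Com f g) (s t : H ⊗[k] H) :
    ev2 f g (s * t) = ev2 f g s * ev2 f g t :=
  mulMap_mul f g.toLinearMap (fun m n => map_mul g m n) hfg s t

theorem commute_ev2 {f g : H →ₐ[k] B} {b : B} (hf : ∀ x, Commute b (f x))
    (hg : ∀ x, Commute b (g x)) (t : H ⊗[k] H) : Commute b (ev2 f g t) :=
  commute_mulMap hf hg t

theorem ev3_mul {f g h : H →ₐ[k] B} (hfg : Com f g) (hfh : Com f h) (hgh : Com g h)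
    (s t : H ⊗[k] (H ⊗[k] H)) : ev3 f g h (s * t) = ev3 f g h s * ev3 f g h t :=
  mulMap_mul f _ (ev2_mul hgh) (fun x => commute_ev2 (hfg x) (hfh x)) s t

theorem commute_ev3 {f g h : H →ₐ[k] B} {b : B} (hf : ∀ x, Commute b (f x))
    (hg : ∀ x, Commute b (g x)) (hh : ∀ x, Commute b (h x)) (t : H ⊗[k] (H ⊗[k] H)) :
    Commute b (ev3 f g h t) :=
  commute_mulMap hf (commute_ev2 hg hh) t

theorem ev4_mul {f g h i : H →ₐ[k] B} (hfg : Com f g) (hfh : Com f h) (hfi : Com f i)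
    (hgh : Com g h) (hgi : Com g i) (hhi : Com h i) (s t : H ⊗[k] (H ⊗[k] (H ⊗[k] H))) :
    ev4 f g h i (s * t) = ev4 f g h i s * ev4 f g h i t :=
  mulMap_mul f _ (ev3_mul hgh hgi hhi) (fun x => commute_ev3 (hfg x) (hfh x) (hfi x)) s t

@[simp]
theorem ev2_one (f g : H →ₐ[k] B) : ev2 f g 1 = 1 := by
  rw [Algebra.TensorProduct.one_def, ev2_tmul, map_one, map_one, one_mul]

@[simp]
theorem ev3_one (f g h : H →ₐ[k] B) : ev3 f g h 1 = 1 := by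
  rw [Algebra.TensorProduct.one_def, ev3_tmul, map_one, ev2_one, one_mul]

variable (Q : QuasiHopfAlgebra k H)

open Classical in
/-- The convolution product `x ↦ f(x₍₁₎) g(x₍₂₎)` of two algebra maps with commuting images
(and `f` if the images do not commute). -/
def cv (f g : H →ₐ[k] B) : H →ₐ[k] B :=
  if h : Com f g then (Algebra.TensorProduct.lift f g h).comp Q.comul else f

open Classical in
/-- The image of `φ` under the algebra map `x ⊗ y ⊗ z ↦ f(x) g(y) h(z)`, for algebra maps with
commuting images (and `1` if the images do not commute). -/
def ph (f g h : H →ₐ[k] B) : Bˣ :=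
  if hc : Com f g ∧ Com f h ∧ Com g h then
    { val := ev3 f g h Q.phi
      inv := ev3 f g h Q.phiInv
      val_inv := by
        rw [← ev3_mul hc.1 hc.2.1 hc.2.2, phiInv, Units.mul_inv, ev3_one]
      inv_val := by
        rw [← ev3_mul hc.1 hc.2.1 hc.2.2, phiInv, Units.inv_mul, ev3_one] }
  else 1

variable {Q}

theorem cv_apply {f g : H →ₐ[k] B} (hfg : Com f g) (x : H) :
    Q.cv f g x = ev2 f g (Q.comul x) := by
  rw [cv, dif_pos hfg, AlgHom.comp_apply]
  generalize Q.comul x = t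
  induction t with
  | zero => simp
  | add x y hx hy => simp only [map_add, hx, hy]
  | tmul x y => exact Algebra.TensorProduct.lift_tmul _ _ _ _ _

theorem coe_ph {f g h : H →ₐ[k] B} (hfg : Com f g) (hfh : Com f h) (hgh : Com g h) :
    (Q.ph f g h : B) = ev3 f g h Q.phi := by
  rw [ph, dif_pos ⟨hfg, hfh, hgh⟩]

theorem coe_ph_inv {f g h : H →ₐ[k] B} (hfg : Com f g) (hfh : Com f h) (hgh : Com g h) :
    ((Q.ph f g h)⁻¹ : Bˣ) = ev3 f g h Q.phiInv := by
  rw [ph, dif_pos ⟨hfg, hfh, hgh⟩]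
  rfl

/-- The default value `f` of `cv` keeps this true even when `f` and `g` do not commute, so
commutation goals about nested convolutions never create side conditions and `apply_rules` closes
them. -/
theorem commute_cv {f g : H →ₐ[k] B} {b : B} (hf : ∀ x, Commute b (f x))
    (hg : ∀ x, Commute b (g x)) (x : H) : Commute b (Q.cv f g x) := by
  by_cases hc : Com f g
  · rw [cv_apply hc]
    exact commute_ev2 hf hg _
  · rw [cv, dif_neg hc]
    exact hf x

theorem com_cv_right {f g h : H →ₐ[k] B} (hf : Com h f) (hg : Com h g) : Com h (Q.cv f g) :=
  fun x => commute_cv (hf x) (hg x)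

theorem com_cv_left {f g h : H →ₐ[k] B} (hf : Com f h) (hg : Com g h) : Com (Q.cv f g) h :=
  (com_cv_right hf.symm hg.symm).symm

theorem mulMap_cv {f g : H →ₐ[k] B} (hfg : Com f g) (L : M →ₗ[k] B) (t : H ⊗[k] M) :
    mulMap (Q.cv f g) L t = mulMap f (mulMap g L) (comulFst Q.comul M t) := by
  induction t with
  | zero => simp
  | add x y hx hy => simp only [map_add, hx, hy]
  | tmul x m =>
    rw [mulMap_tmul, cv_apply hfg, comulFst, LinearMap.comp_apply, TensorProduct.map_tmul]
    simp only [AlgHom.toLinearMap_apply, LinearMap.id_apply]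
    generalize Q.comul x = t
    induction t with
    | zero => simp
    | add x y hx hy => simp only [map_add, TensorProduct.add_tmul, add_mul, hx, hy]
    | tmul x y => simp [mul_assoc]

theorem cv_toLinearMap {f g : H →ₐ[k] B} (hfg : Com f g) :
    (Q.cv f g).toLinearMap = ev2 f g ∘ₗ Q.comul.toLinearMap :=
  LinearMap.ext fun x => cv_apply hfg x

theorem semiconj_ev2 {f g f' g' : H →ₐ[k] B} {b : B} (hf : ∀ x, SemiconjBy b (f x) (f' x))
    (hg : ∀ x, SemiconjBy b (g x) (g' x)) (t : H ⊗[k] H) :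
    SemiconjBy b (ev2 f g t) (ev2 f' g' t) := by
  induction t with
  | zero => simp
  | add x y hx hy => simpa only [map_add] using hx.add_right hy
  | tmul x m => exact (hf x).mul_right (hg m)

theorem semiconj_ev3 {f g h f' g' h' : H →ₐ[k] B} {b : B}
    (hf : ∀ x, SemiconjBy b (f x) (f' x)) (hg : ∀ x, SemiconjBy b (g x) (g' x))
    (hh : ∀ x, SemiconjBy b (h x) (h' x)) (t : H ⊗[k] (H ⊗[k] H)) :
    SemiconjBy b (ev3 f g h t) (ev3 f' g' h' t) := by
  induction t with
  | zero => simp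
  | add x y hx hy => simpa only [map_add] using hx.add_right hy
  | tmul x m => exact (hf x).mul_right (semiconj_ev2 hg hh m)

theorem semiconj_cv {f g f' g' : H →ₐ[k] B} {b : B} (hfg : Com f g) (hfg' : Com f' g')
    (hf : ∀ x, SemiconjBy b (f x) (f' x))
    (hg : ∀ x, SemiconjBy b (g x) (g' x)) (x : H) :
    SemiconjBy b (Q.cv f g x) (Q.cv f' g' x) := by
  rw [cv_apply hfg, cv_apply hfg']
  exact semiconj_ev2 hf hg _

/-- Pairwise commutation of three algebra maps. -/
structure Com3 (f g h : H →ₐ[k] B) : Prop where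
  h12 : Com f g
  h13 : Com f h
  h23 : Com g h

theorem Com3.coe_ph {f g h : H →ₐ[k] B} (c : Com3 f g h) :
    (Q.ph f g h : B) = ev3 f g h Q.phi := QuasiHopfAlgebra.coe_ph c.1 c.2 c.3

theorem Com3.coe_ph_inv {f g h : H →ₐ[k] B} (c : Com3 f g h) :
    ((Q.ph f g h)⁻¹ : Bˣ) = ev3 f g h Q.phiInv := QuasiHopfAlgebra.coe_ph_inv c.1 c.2 c.3

theorem semiconj_ph {f g h f' g' h' : H →ₐ[k] B} {b : Bˣ} (c : Com3 f g h) (c' : Com3 f' g' h')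
    (hf : ∀ x, SemiconjBy (b : B) (f x) (f' x)) (hg : ∀ x, SemiconjBy (b : B) (g x) (g' x))
    (hh : ∀ x, SemiconjBy (b : B) (h x) (h' x)) :
    SemiconjBy b (Q.ph f g h) (Q.ph f' g' h') := by
  refine Units.ext ?_
  rw [Units.val_mul, Units.val_mul, c.coe_ph, c'.coe_ph]
  exact semiconj_ev3 hf hg hh _

theorem commute_ph {f g h : H →ₐ[k] B} {b : B} (c : Com3 f g h) (hf : ∀ x, Commute b (f x))
    (hg : ∀ x, Commute b (g x)) (hh : ∀ x, Commute b (h x)) :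
    Commute b (Q.ph f g h : B) := by
  rw [c.coe_ph]
  exact commute_ev3 hf hg hh _

/-- Quasi-coassociativity. -/
theorem ph_semiconj_cv {f g h : H →ₐ[k] B} (c : Com3 f g h) (x : H) :
    SemiconjBy (Q.ph f g h : B) (Q.cv (Q.cv f g) h x) (Q.cv f (Q.cv g h) x) := by
  have e1 : Q.cv (Q.cv f g) h x = ev3 f g h (comulFst Q.comul H (Q.comul x)) := by
    rw [cv_apply (com_cv_left c.2 c.3)]
    exact mulMap_cv c.1 _ _
  have e2 : Q.cv f (Q.cv g h) x =
      ev3 f g h (TensorProduct.map LinearMap.id Q.comul.toLinearMap (Q.comul x)) := by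
    rw [cv_apply (com_cv_right c.1 c.2), ev3, mulMap_map, ev2, cv_toLinearMap c.3]
  rw [e1, e2, c.coe_ph, SemiconjBy, ← ev3_mul c.1 c.2 c.3, ← ev3_mul c.1 c.2 c.3, Q.coassoc,
    mul_assoc, Units.inv_mul, mul_one]

/-- The pentagon identity. -/
theorem ph_pentagon {f g h i : H →ₐ[k] B} (hfg : Com f g) (hfh : Com f h) (hfi : Com f i)
    (hgh : Com g h) (hgi : Com g i) (hhi : Com h i) :
    Q.ph f g (Q.cv h i) * Q.ph (Q.cv f g) h i =
      Q.ph g h i * Q.ph f (Q.cv g h) i * Q.ph f g h := by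
  refine Units.ext ?_
  simp only [Units.val_mul]
  rw [coe_ph hfg (com_cv_right hfh hfi) (com_cv_right hgh hgi),
    coe_ph (com_cv_left hfh hgh) (com_cv_left hfi hgi) hhi, coe_ph hgh hgi hhi,
    coe_ph (com_cv_right hfg hfh) hfi (com_cv_left hgi hhi), coe_ph hfg hfh hgh]
  have e := congrArg (ev4 f g h i) Q.pentagon
  simp only [ev4_mul hfg hfh hfi hgh hgi hhi] at e
  convert e using 2
  · rw [ev4, mulMap_map, ev3, ev2, cv_toLinearMap hhi]
    congr 2
    ext x y
    simp [ev3, ev2]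
  · exact mulMap_cv hfg _ _
  · congr 1
    · rw [ev4_tmul, map_one, one_mul]
    · rw [ev4, mulMap_map, ev3]
      congr 2
      exact LinearMap.ext fun t => mulMap_cv hgh _ t
  · rw [ev4, mulMap_map, ev3]
    congr 2
    ext x y
    simp

end Calculus

end QuasiHopfAlgebra

namespace QuasiHopfAlgebra

/-! ### Coherence identities for five and six legs. -/

section Coherence

variable {k : Type u} {H : Type v} [Field k] [Ring H] [Algebra k H]
variable {B : Type*} [Ring B] [Algebra k B] {Q : QuasiHopfAlgebra k H}

variable (Q) in
/-- The image of `(Δ ⊗ id ⊗ id)(φ) (φ⁻¹ ⊗ 1)` under `x ⊗ y ⊗ z ⊗ w ↦ f(x) g(y) h(z) i(w)`. -/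
def theta (f g h i : H →ₐ[k] B) : Bˣ := Q.ph (Q.cv f g) h i * (Q.ph f g h)⁻¹

/-- `h₂` and `h₃` are two pentagons with the common term `e`, and `h₁` is a conjugation by an
associator. The unknowns `w` and `e` are eliminated. -/
theorem coherence_five_group {G : Type*} [Group G] {a x y z w c d e t r : G}
    (h₁ : SemiconjBy x w y) (h₂ : a * w = c * d * e) (h₃ : t * e = r * z * x) :
    a * x⁻¹ * y * z⁻¹ = c * d * t⁻¹ * r := by
  have hy : y = x * w * x⁻¹ := by rw [h₁.eq]; group
  have ha : a = c * d * e * w⁻¹ := by rw [← h₂]; group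
  have he : e = t⁻¹ * (r * z * x) := by rw [← h₃]; group
  rw [hy, ha, he]
  group

/-- A coherence identity between re-bracketings of a fivefold tensor product. -/
theorem ph_coherence_five {f g h i j : H →ₐ[k] B} (hfg : Com f g) (hfh : Com f h)
    (hfi : Com f i) (hfj : Com f j) (hgh : Com g h) (hgi : Com g i) (hgj : Com g j)
    (hhi : Com h i) (hhj : Com h j) (hij : Com i j) :
    Q.ph (Q.cv f g) h (Q.cv i j) * (Q.ph f g h)⁻¹ * Q.ph (Q.cv f (Q.cv g h)) i j *
        (Q.ph f (Q.cv g h) i)⁻¹ =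
      Q.ph h i j * Q.ph (Q.cv f g) (Q.cv h i) j * (Q.ph f g (Q.cv h i))⁻¹ * Q.ph g h i := by
  have c : Com3 f g h := ⟨hfg, hfh, hgh⟩
  refine coherence_five_group (w := Q.ph (Q.cv (Q.cv f g) h) i j)
    (e := Q.ph (Q.cv f g) h i) ?_ ?_ ?_
  · refine semiconj_ph ?_ ?_ (ph_semiconj_cv c) (fun x => ?_) (fun x => ?_)
    · constructor <;> apply_rules [com_cv_left, com_cv_right]
    · constructor <;> apply_rules [com_cv_left, com_cv_right]
    · exact (commute_ph c (hfi.symm x) (hgi.symm x) (hhi.symm x)).symm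
    · exact (commute_ph c (hfj.symm x) (hgj.symm x) (hhj.symm x)).symm
  · apply ph_pentagon <;> apply_rules [com_cv_left, com_cv_right]
  · apply ph_pentagon <;> apply_rules [com_cv_left, com_cv_right]

/-- `h₂` is a pentagon on the legs 0 to 3 and `h₅` is the five-leg coherence with the legs 1 and 2
fused. The remaining hypotheses rebracket by conjugation with the associators `p` and `r`. -/
theorem coherence_six_group {G : Type*} [Group G] {p n n' s s' u v m m' o o' R q l r : G}
    (h₁ : SemiconjBy p n n') (h₂ : u * s = r * v * p) (h₃ : SemiconjBy r m m')
    (h₄ : SemiconjBy r o o') (h₅ : n' * v⁻¹ * m * o⁻¹ = R * q * l⁻¹ * s') :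
    p * (n * s⁻¹) * u⁻¹ * (m' * o'⁻¹) = R * (q * l⁻¹) * (s' * r⁻¹) := by
  have hn : n = p⁻¹ * n' * p := by rw [mul_assoc, ← h₁.eq]; group
  have hm : m' = r * m * r⁻¹ := by rw [h₃.eq]; group
  have ho : o' = r * o * r⁻¹ := by rw [h₄.eq]; group
  have hu : u = r * v * p * s⁻¹ := by rw [← h₂]; group
  have hR : R = n' * v⁻¹ * m * o⁻¹ * s'⁻¹ * l * q⁻¹ := by rw [h₅]; group
  rw [hn, hm, ho, hu, hR]
  group

/-- The coherence identity behind the coassociativity of `ω` and behind the compatibility of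
Drinfeld's twist with `φ`. -/
theorem theta_coherence {f₀ f₁ f₂ f₃ f₄ f₅ : H →ₐ[k] B}
    (hf : [f₀, f₁, f₂, f₃, f₄, f₅].Pairwise Com) :
    Q.ph f₀ f₁ f₂ * Q.theta (Q.cv f₀ f₁) f₂ f₃ (Q.cv f₄ f₅) *
        (Q.ph f₀ f₁ (Q.cv f₂ f₃))⁻¹ *
        Q.theta f₀ (Q.cv f₁ (Q.cv f₂ f₃)) f₄ f₅ =
      Q.ph f₃ f₄ f₅ * Q.theta f₀ (Q.cv f₁ f₂) (Q.cv f₃ f₄) f₅ *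
        Q.theta f₁ f₂ f₃ f₄ := by
  simp only [List.pairwise_cons, List.mem_cons, List.not_mem_nil, or_false, forall_eq_or_imp,
    forall_eq, IsEmpty.forall_iff, implies_true, List.Pairwise.nil, and_true] at hf
  obtain ⟨⟨h01, h02, h03, h04, h05⟩, ⟨h12, h13, h14, h15⟩, ⟨h23, h24, h25⟩, ⟨h34, h35⟩, h45⟩ := hf
  have c : Com3 f₀ f₁ f₂ := ⟨h01, h02, h12⟩
  have d : Com3 f₁ f₂ f₃ := ⟨h12, h13, h23⟩
  have hd0 : ∀ x, SemiconjBy (Q.ph f₁ f₂ f₃ : B) (f₀ x) (f₀ x) :=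
    fun x => (commute_ph d (h01 x) (h02 x) (h03 x)).symm
  have hd4 : ∀ x, SemiconjBy (Q.ph f₁ f₂ f₃ : B) (f₄ x) (f₄ x) :=
    fun x => (commute_ph d (h14.symm x) (h24.symm x) (h34.symm x)).symm
  have hd5 : ∀ x, SemiconjBy (Q.ph f₁ f₂ f₃ : B) (f₅ x) (f₅ x) :=
    fun x => (commute_ph d (h15.symm x) (h25.symm x) (h35.symm x)).symm
  -- The four terms given explicitly are those of the five-leg coherence for `f₀, f₁f₂, f₃, f₄, f₅`;
  -- they cancel and do not occur in the goal.
  refine coherence_six_group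
    (n' := Q.ph (Q.cv f₀ (Q.cv f₁ f₂)) f₃ (Q.cv f₄ f₅))
    (v := Q.ph f₀ (Q.cv f₁ f₂) f₃)
    (m := Q.ph (Q.cv f₀ (Q.cv (Q.cv f₁ f₂) f₃)) f₄ f₅)
    (o := Q.ph f₀ (Q.cv (Q.cv f₁ f₂) f₃) f₄) ?_ ?_ ?_ ?_ ?_
  · refine semiconj_ph ?_ ?_ (ph_semiconj_cv c) (fun x => ?_) (fun x => ?_)
    · constructor <;> apply_rules [com_cv_left, com_cv_right]
    · constructor <;> apply_rules [com_cv_left, com_cv_right]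
    · exact (commute_ph c (h03.symm x) (h13.symm x) (h23.symm x)).symm
    · exact (commute_ph c (com_cv_left h04.symm h05.symm x) (com_cv_left h14.symm h15.symm x)
        (com_cv_left h24.symm h25.symm x)).symm
  · apply ph_pentagon <;> apply_rules [com_cv_left, com_cv_right]
  · refine semiconj_ph ?_ ?_ (semiconj_cv ?_ ?_ hd0 (ph_semiconj_cv d)) hd4 hd5
    · constructor <;> apply_rules [com_cv_left, com_cv_right]
    · constructor <;> apply_rules [com_cv_left, com_cv_right]
    · apply_rules [com_cv_left, com_cv_right]
    · apply_rules [com_cv_left, com_cv_right]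
  · refine semiconj_ph ?_ ?_ hd0 (ph_semiconj_cv d) hd4
    · constructor <;> apply_rules [com_cv_left, com_cv_right]
    · constructor <;> apply_rules [com_cv_left, com_cv_right]
  · apply ph_coherence_five <;> apply_rules [com_cv_left, com_cv_right]

end Coherence

end QuasiHopfAlgebra

namespace QuasiHopfAlgebra

/-! ### Trivial legs. -/

section Trivial

variable {k : Type u} {H : Type v} [Field k] [Ring H] [Algebra k H]
variable {B : Type*} [Ring B] [Algebra k B] {Q : QuasiHopfAlgebra k H}

variable (Q B) in
/-- The algebra map `x ↦ ε(x) 1`. -/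
def triv : H →ₐ[k] B := (Algebra.ofId k B).comp Q.counit

theorem triv_apply (x : H) : Q.triv B x = algebraMap k B (Q.counit x) := rfl

theorem commute_triv (b : B) (x : H) : Commute b (Q.triv B x) :=
  (Algebra.commutes _ b).symm

theorem com_triv_right (f : H →ₐ[k] B) : Com f (Q.triv B) := fun _ _ => commute_triv _ _

theorem com_triv_left (f : H →ₐ[k] B) : Com (Q.triv B) f := (com_triv_right f).symm

theorem ev2_triv_right (f : H →ₐ[k] B) (t : H ⊗[k] H) : ev2 f (Q.triv B) t =
    f (TensorProduct.rid k H (TensorProduct.map LinearMap.id Q.counit.toLinearMap t)) := by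
  induction t with
  | zero => simp
  | add x y hx hy => simp only [map_add, hx, hy]
  | tmul x y => simp [triv_apply, Algebra.smul_def, (Algebra.commutes _ (f x)).symm]

theorem ev2_triv_left (f : H →ₐ[k] B) (t : H ⊗[k] H) : ev2 (Q.triv B) f t =
    f (TensorProduct.lid k H (TensorProduct.map Q.counit.toLinearMap LinearMap.id t)) := by
  induction t with
  | zero => simp
  | add x y hx hy => simp only [map_add, hx, hy]
  | tmul x y => simp [triv_apply, Algebra.smul_def]

@[simp]
theorem cv_triv_right (f : H →ₐ[k] B) : Q.cv f (Q.triv B) = f := by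
  ext x
  rw [cv_apply (com_triv_right f), ev2_triv_right, Q.counit_right]

@[simp]
theorem cv_triv_left (f : H →ₐ[k] B) : Q.cv (Q.triv B) f = f := by
  ext x
  rw [cv_apply (com_triv_left f), ev2_triv_left, Q.counit_left]

theorem ph_triv_mid {f h : H →ₐ[k] B} (hfh : Com f h) : Q.ph f (Q.triv B) h = 1 := by
  refine Units.ext ?_
  rw [coe_ph (com_triv_right f) hfh (com_triv_left h), Units.val_one, ← ev2_one f h,
    ← Q.counit_phi, ev2, mulMap_map, ev3]
  congr 2
  ext x y
  simp [triv_apply, Algebra.smul_def]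

/-- The axiom normalizes only the middle leg. In the pentagon with its first two legs trivial, the
middle normalization leaves `p = p * p` for the unit `p`, hence `p = 1`. -/
theorem ph_triv_left {g h : H →ₐ[k] B} (hgh : Com g h) : Q.ph (Q.triv B) g h = 1 := by
  have e := ph_pentagon (Q := Q) (com_triv_left (Q := Q) (Q.triv B)) (com_triv_left g)
    (com_triv_left h) (com_triv_left g) (com_triv_left h) hgh
  rw [cv_triv_left, cv_triv_left, ph_triv_mid (com_triv_left _), ph_triv_mid (com_triv_left _),
    mul_one, one_mul] at e
  exact left_eq_mul.mp e

theorem ph_triv_right {f g : H →ₐ[k] B} (hfg : Com f g) : Q.ph f g (Q.triv B) = 1 := by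
  have e := ph_pentagon (Q := Q) hfg (com_triv_right (Q := Q) f) (com_triv_right (Q := Q) f)
    (com_triv_right (Q := Q) g) (com_triv_right (Q := Q) g) (com_triv_left (Q := Q) (Q.triv B))
  rw [cv_triv_left, cv_triv_right, ph_triv_mid (com_triv_right _), ph_triv_mid (com_triv_right _),
    mul_one, one_mul] at e
  exact right_eq_mul.mp e

end Trivial

/-! ### Legs acting on one vector, or seen through a linear map. -/

section Action

variable {k : Type u} {H : Type v} [Field k] [Ring H] [Algebra k H]
variable {V : Type*} [AddCommGroup V] [Module k V] {W : Type*} [AddCommGroup W] [Module k W]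
variable {Q : QuasiHopfAlgebra k H}

/-- Commutation lets the first leg act on `v` before the other, so only its values at `v` matter. -/
theorem ev2_apply_congr_left {f f' g : H →ₐ[k] Module.End k V} {v : V} (hfg : Com f g)
    (hfg' : Com f' g) (e : ∀ x, f x v = f' x v) (t : H ⊗[k] H) :
    ev2 f g t v = ev2 f' g t v := by
  induction t with
  | zero => simp
  | add x y hx hy => simp only [map_add, LinearMap.add_apply, hx, hy]
  | tmul x y =>
    rw [ev2_tmul, ev2_tmul, (hfg x y).eq, (hfg' x y).eq, Module.End.mul_apply,
      Module.End.mul_apply, e]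

theorem ev2_apply_congr_right {f g g' : H →ₐ[k] Module.End k V} {v : V}
    (e : ∀ x, g x v = g' x v) (t : H ⊗[k] H) : ev2 f g t v = ev2 f g' t v := by
  induction t with
  | zero => simp
  | add x y hx hy => simp only [map_add, LinearMap.add_apply, hx, hy]
  | tmul x y => rw [ev2_tmul, ev2_tmul, Module.End.mul_apply, Module.End.mul_apply, e]

theorem ev3_apply_congr_left {f f' g h : H →ₐ[k] Module.End k V} {v : V} (hfg : Com f g)
    (hfg' : Com f' g) (hfh : Com f h) (hfh' : Com f' h) (e : ∀ x, f x v = f' x v)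
    (t : H ⊗[k] (H ⊗[k] H)) : ev3 f g h t v = ev3 f' g h t v := by
  induction t with
  | zero => simp
  | add x y hx hy => simp only [map_add, LinearMap.add_apply, hx, hy]
  | tmul x y =>
    rw [ev3_tmul, ev3_tmul, (commute_ev2 (hfg x) (hfh x) y).eq,
      (commute_ev2 (hfg' x) (hfh' x) y).eq, Module.End.mul_apply, Module.End.mul_apply, e]

theorem ev3_apply_congr_mid {f g g' h : H →ₐ[k] Module.End k V} {v : V} (hgh : Com g h)
    (hgh' : Com g' h) (e : ∀ x, g x v = g' x v)
    (t : H ⊗[k] (H ⊗[k] H)) : ev3 f g h t v = ev3 f g' h t v := by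
  induction t with
  | zero => simp
  | add x y hx hy => simp only [map_add, LinearMap.add_apply, hx, hy]
  | tmul x y =>
    rw [ev3_tmul, ev3_tmul, Module.End.mul_apply, Module.End.mul_apply,
      ev2_apply_congr_left hgh hgh' e]

theorem ev3_apply_congr_right {f g h h' : H →ₐ[k] Module.End k V} {v : V}
    (e : ∀ x, h x v = h' x v)
    (t : H ⊗[k] (H ⊗[k] H)) : ev3 f g h t v = ev3 f g h' t v := by
  induction t with
  | zero => simp
  | add x y hx hy => simp only [map_add, LinearMap.add_apply, hx, hy]
  | tmul x y =>
    rw [ev3_tmul, ev3_tmul, Module.End.mul_apply, Module.End.mul_apply,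
      ev2_apply_congr_right e]

theorem cv_apply_congr_left {f f' g : H →ₐ[k] Module.End k V} {v : V} (hfg : Com f g)
    (hfg' : Com f' g) (e : ∀ x, f x v = f' x v) (x : H) :
    Q.cv f g x v = Q.cv f' g x v := by
  rw [cv_apply hfg, cv_apply hfg', ev2_apply_congr_left hfg hfg' e]

theorem cv_apply_congr_right {f g g' : H →ₐ[k] Module.End k V} {v : V} (hfg : Com f g)
    (hfg' : Com f g') (e : ∀ x, g x v = g' x v) (x : H) :
    Q.cv f g x v = Q.cv f g' x v := by
  rw [cv_apply hfg, cv_apply hfg', ev2_apply_congr_right e]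

theorem units_inv_apply {p : (Module.End k V)ˣ} {v w : V} (h : (p : Module.End k V) v = w) :
    ((p⁻¹ : (Module.End k V)ˣ) : Module.End k V) w = v := by
  rw [← h, ← Module.End.mul_apply, Units.inv_mul, Module.End.one_apply]

theorem triv_end_apply (x : H) (v : V) : Q.triv (Module.End k V) x v = Q.counit x • v := by
  rw [triv_apply, Module.algebraMap_end_apply]

/-- On the vector `v` the leg `e` may be replaced by `triv`, and an associator with a trivial leg is
`1`. -/
theorem ph_apply_left {e g h : H →ₐ[k] Module.End k V} {v : V} (c : Com3 e g h)
    (he : ∀ x, e x v = Q.counit x • v) : (Q.ph e g h : Module.End k V) v = v := by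
  rw [c.coe_ph, ev3_apply_congr_left c.1 (com_triv_left (Q := Q) g) c.2 (com_triv_left h)
      fun x => (he x).trans (triv_end_apply x v).symm,
    ← coe_ph (com_triv_left g) (com_triv_left h) c.3, ph_triv_left c.3]
  rfl

theorem ph_apply_right {f g e : H →ₐ[k] Module.End k V} {v : V} (c : Com3 f g e)
    (he : ∀ x, e x v = Q.counit x • v) : (Q.ph f g e : Module.End k V) v = v := by
  rw [c.coe_ph, ev3_apply_congr_right (h' := Q.triv _)
      fun x => (he x).trans (triv_end_apply x v).symm,
    ← coe_ph c.1 (com_triv_right f) (com_triv_right g), ph_triv_right c.1]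
  rfl

/-- A linear map that commutes with the operators `f(x)` and `f'(x)`. -/
def Intertwines (π : V →ₗ[k] W) (f : H →ₐ[k] Module.End k V) (f' : H →ₐ[k] Module.End k W) :
    Prop := ∀ x v, π (f x v) = f' x (π v)

theorem intertwines_ev2 {π : V →ₗ[k] W} {f g : H →ₐ[k] Module.End k V}
    {f' g' : H →ₐ[k] Module.End k W} (hf : Intertwines π f f') (hg : Intertwines π g g')
    (t : H ⊗[k] H) (v : V) : π (ev2 f g t v) = ev2 f' g' t (π v) := by
  induction t with
  | zero => simp
  | add x y hx hy => simp only [map_add, LinearMap.add_apply, hx, hy]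
  | tmul x y => simp only [ev2_tmul, Module.End.mul_apply, hf x, hg y]

theorem intertwines_ev3 {π : V →ₗ[k] W} {f g h : H →ₐ[k] Module.End k V}
    {f' g' h' : H →ₐ[k] Module.End k W} (hf : Intertwines π f f') (hg : Intertwines π g g')
    (hh : Intertwines π h h') (t : H ⊗[k] (H ⊗[k] H)) (v : V) :
    π (ev3 f g h t v) = ev3 f' g' h' t (π v) := by
  induction t with
  | zero => simp
  | add x y hx hy => simp only [map_add, LinearMap.add_apply, hx, hy]
  | tmul x y => simp only [ev3_tmul, Module.End.mul_apply, hf x, intertwines_ev2 hg hh]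

theorem intertwines_cv {π : V →ₗ[k] W} {f g : H →ₐ[k] Module.End k V}
    {f' g' : H →ₐ[k] Module.End k W} (hfg : Com f g) (hfg' : Com f' g')
    (hf : Intertwines π f f') (hg : Intertwines π g g') :
    Intertwines π (Q.cv f g) (Q.cv f' g') := by
  intro x v
  rw [cv_apply hfg, cv_apply hfg', intertwines_ev2 hf hg]

theorem intertwines_ph {π : V →ₗ[k] W} {f g h : H →ₐ[k] Module.End k V}
    {f' g' h' : H →ₐ[k] Module.End k W} (c : Com3 f g h) (c' : Com3 f' g' h')
    (hf : Intertwines π f f') (hg : Intertwines π g g') (hh : Intertwines π h h') (v : V) :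
    π ((Q.ph f g h : Module.End k V) v) = (Q.ph f' g' h' : Module.End k W) (π v) := by
  rw [c.coe_ph, c'.coe_ph, intertwines_ev3 hf hg hh]

theorem intertwines_inv {π : V →ₗ[k] W} {p : (Module.End k V)ˣ} {q : (Module.End k W)ˣ}
    (e : ∀ v, π ((p : Module.End k V) v) = (q : Module.End k W) (π v)) (v : V) :
    π (((p⁻¹ : (Module.End k V)ˣ) : Module.End k V) v) =
      ((q⁻¹ : (Module.End k W)ˣ) : Module.End k W) (π v) := by
  refine (units_inv_apply ?_).symm
  rw [← e, ← Module.End.mul_apply, Units.mul_inv, Module.End.one_apply]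

theorem intertwines_theta {π : V →ₗ[k] W} {f g h i : H →ₐ[k] Module.End k V}
    {f' g' h' i' : H →ₐ[k] Module.End k W} (c : [f, g, h, i].Pairwise Com)
    (c' : [f', g', h', i'].Pairwise Com)
    (hf : Intertwines π f f') (hg : Intertwines π g g') (hh : Intertwines π h h')
    (hi : Intertwines π i i') (v : V) :
    π ((Q.theta f g h i : Module.End k V) v) =
      (Q.theta f' g' h' i' : Module.End k W) (π v) := by
  simp only [List.pairwise_cons, List.mem_cons, List.not_mem_nil, or_false, forall_eq_or_imp,
    forall_eq, IsEmpty.forall_iff, implies_true, List.Pairwise.nil, and_true] at c c'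
  obtain ⟨⟨h01, h02, h03⟩, ⟨h12, h13⟩, h23⟩ := c
  obtain ⟨⟨h01', h02', h03'⟩, ⟨h12', h13'⟩, h23'⟩ := c'
  rw [theta, theta, Units.val_mul, Units.val_mul, Module.End.mul_apply, Module.End.mul_apply,
    intertwines_ph ⟨com_cv_left h02 h12, com_cv_left h03 h13, h23⟩
      ⟨com_cv_left h02' h12', com_cv_left h03' h13', h23'⟩ (intertwines_cv h01 h01' hf hg) hh hi,
    intertwines_inv (intertwines_ph ⟨h01, h02, h12⟩ ⟨h01', h02', h12'⟩ hf hg hh)]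

/-- Dual to `ph_apply_left`: the leg is commuted to the far left, where `π` sees it as trivial. -/
theorem ph_covector_mid {π : V →ₗ[k] W} {f e h : H →ₐ[k] Module.End k V} (c : Com3 f e h)
    (he : ∀ x v, π (e x v) = Q.counit x • π v) (v : V) :
    π ((Q.ph f e h : Module.End k V) v) = π v := by
  have key : ∀ t, π (ev3 f e h t v) = π (ev3 f (Q.triv _) h t v) := by
    intro t
    induction t with
    | zero => simp
    | add x y hx hy => simp only [map_add, LinearMap.add_apply, hx, hy]
    | tmul x y =>
      induction y with
      | zero => simp
      | add x y hx hy =>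
        simp only [map_add, LinearMap.add_apply, hx, hy, TensorProduct.tmul_add]
      | tmul y z =>
        simp only [ev3_tmul, ev2_tmul]
        rw [← mul_assoc, ← mul_assoc, (c.1 x y).eq, (com_triv_right (Q := Q) f x y).eq]
        simp only [Module.End.mul_apply, he, triv_end_apply, map_smul]
  rw [c.coe_ph, key, ← coe_ph (com_triv_right f) c.2 (com_triv_left h), ph_triv_mid c.2]
  rfl

end Action

end QuasiHopfAlgebra

namespace QuasiHopfAlgebra

/-! ### Left and right multiplications, and antipodes, as legs. -/

section Multiplication

variable {k : Type u} {H : Type v} [Field k] [Ring H] [Algebra k H]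
variable {B : Type*} [Ring B] [Algebra k B] {Q : QuasiHopfAlgebra k H}
variable {V : Type*} [AddCommGroup V] [Module k V] {W : Type*} [AddCommGroup W] [Module k W]

/-- Left multiplication by `f(x)`. -/
def lm (f : H →ₐ[k] B) : H →ₐ[k] Module.End k B := (Algebra.lmul k B).comp f

/-- Right multiplication by `g(x)`. -/
def rm (g : H →ₐ[k] Bᵐᵒᵖ) : H →ₐ[k] Module.End k B :=
  ((AlgHom.mulLeftRight k B).comp Algebra.TensorProduct.includeRight).comp g

@[simp]
theorem lm_apply (f : H →ₐ[k] B) (x : H) (b : B) : lm f x b = f x * b := rfl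

@[simp]
theorem rm_apply (g : H →ₐ[k] Bᵐᵒᵖ) (x : H) (b : B) : rm g x b = b * (g x).unop := by
  simp [rm]

theorem com_lm_rm (f : H →ₐ[k] B) (g : H →ₐ[k] Bᵐᵒᵖ) : Com (lm f) (rm g) := fun x y =>
  LinearMap.ext fun b => by simp [mul_assoc]

theorem com_lm {f g : H →ₐ[k] B} (h : Com f g) : Com (lm f) (lm g) := fun x y =>
  LinearMap.ext fun b => by simp [← mul_assoc, (h x y).eq]

theorem com_rm {f g : H →ₐ[k] Bᵐᵒᵖ} (h : Com f g) : Com (rm f) (rm g) := fun x y =>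
  LinearMap.ext fun b => by
    have e := congrArg MulOpposite.unop (h x y).eq
    simp only [MulOpposite.unop_mul] at e
    simp [mul_assoc, e]

theorem ev2_lm (f g : H →ₐ[k] B) (t : H ⊗[k] H) (b : B) :
    ev2 (lm f) (lm g) t b = ev2 f g t * b := by
  induction t with
  | zero => simp
  | add x y hx hy => simp only [map_add, LinearMap.add_apply, add_mul, hx, hy]
  | tmul x y => simp [mul_assoc]

theorem ev2_rm (f g : H →ₐ[k] Bᵐᵒᵖ) (t : H ⊗[k] H) (b : B) :
    ev2 (rm f) (rm g) t b = b * (ev2 f g t).unop := by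
  induction t with
  | zero => simp
  | add x y hx hy =>
    simp only [map_add, LinearMap.add_apply, MulOpposite.unop_add, mul_add, hx, hy]
  | tmul x y => simp [mul_assoc]

theorem ev3_rm (f g h : H →ₐ[k] Bᵐᵒᵖ) (t : H ⊗[k] (H ⊗[k] H)) (b : B) :
    ev3 (rm f) (rm g) (rm h) t b = b * (ev3 f g h t).unop := by
  induction t with
  | zero => simp
  | add x y hx hy =>
    simp only [map_add, LinearMap.add_apply, MulOpposite.unop_add, mul_add, hx, hy]
  | tmul x y => simp [mul_assoc, ev2_rm]

theorem cv_lm {f g : H →ₐ[k] B} (h : Com f g) : Q.cv (lm f) (lm g) = lm (Q.cv f g) := by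
  ext x b
  rw [cv_apply (com_lm h), ev2_lm, lm_apply, cv_apply h]

theorem cv_rm {f g : H →ₐ[k] Bᵐᵒᵖ} (h : Com f g) : Q.cv (rm f) (rm g) = rm (Q.cv f g) := by
  ext x b
  rw [cv_apply (com_rm h), ev2_rm, rm_apply, cv_apply h]

theorem ph_rm {f g h : H →ₐ[k] Bᵐᵒᵖ} (c : Com3 f g h) (b : B) :
    (Q.ph (rm f) (rm g) (rm h) : Module.End k B) b =
      b * (Q.ph f g h : Bᵐᵒᵖ).unop := by
  rw [coe_ph (com_rm c.1) (com_rm c.2) (com_rm c.3), ev3_rm, c.coe_ph]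

variable (Q) in
/-- The algebra map `x ↦ a(S(x))` to the opposite algebra. -/
def anti (a : H →ₐ[k] B) : H →ₐ[k] Bᵐᵒᵖ := (AlgHom.op a).comp Q.antipode

@[simp]
theorem unop_anti (a : H →ₐ[k] B) (x : H) : (Q.anti a x).unop = a (Q.S x) := rfl

theorem com_anti {f g : H →ₐ[k] B} (h : Com f g) : Com (Q.anti f) (Q.anti g) := fun x y =>
  MulOpposite.unop_injective <| by
    simp only [MulOpposite.unop_mul, unop_anti]
    exact (h _ _).symm.eq

/-- The operators `f(x) ⊗ id`. -/
def onL (W : Type*) [AddCommGroup W] [Module k W] (f : H →ₐ[k] Module.End k V) :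
    H →ₐ[k] Module.End k (V ⊗[k] W) := (Module.End.rTensorAlgHom k V W).comp f

/-- The operators `id ⊗ f(x)`. -/
def onR (V : Type*) [AddCommGroup V] [Module k V] (f : H →ₐ[k] Module.End k W) :
    H →ₐ[k] Module.End k (V ⊗[k] W) := (Module.End.lTensorAlgHom k W V).comp f

@[simp]
theorem onL_tmul (f : H →ₐ[k] Module.End k V) (x : H) (m : V) (n : W) :
    onL W f x (m ⊗ₜ n) = f x m ⊗ₜ n := rfl

@[simp]
theorem onR_tmul (f : H →ₐ[k] Module.End k W) (x : H) (m : V) (n : W) :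
    onR V f x (m ⊗ₜ n) = m ⊗ₜ f x n := rfl

theorem com_onL_onR (f : H →ₐ[k] Module.End k V) (g : H →ₐ[k] Module.End k W) :
    Com (onL W f) (onR V g) := fun x y => TensorProduct.ext' fun m n => by simp

theorem com_onL {f g : H →ₐ[k] Module.End k V} (h : Com f g) : Com (onL W f) (onL W g) :=
  fun x y => TensorProduct.ext' fun m n => by
    simp only [Module.End.mul_apply, onL_tmul]
    rw [← Module.End.mul_apply, (h x y).eq, Module.End.mul_apply]

theorem com_onR {f g : H →ₐ[k] Module.End k W} (h : Com f g) : Com (onR V f) (onR V g) :=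
  fun x y => TensorProduct.ext' fun m n => by
    simp only [Module.End.mul_apply, onR_tmul]
    rw [← Module.End.mul_apply, (h x y).eq, Module.End.mul_apply]

theorem ev2_onR (f g : H →ₐ[k] Module.End k W) (t : H ⊗[k] H) (m : V) (n : W) :
    ev2 (onR V f) (onR V g) t (m ⊗ₜ n) = m ⊗ₜ ev2 f g t n :=
  (intertwines_ev2 (π := TensorProduct.mk k V W m) (fun _ _ => rfl) (fun _ _ => rfl) t n).symm

theorem cv_onR {f g : H →ₐ[k] Module.End k W} (h : Com f g) :
    Q.cv (onR V f) (onR V g) = onR V (Q.cv f g) := by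
  refine AlgHom.ext fun x => TensorProduct.ext' fun m n => ?_
  rw [cv_apply (com_onR h), ev2_onR, onR_tmul, cv_apply h]

end Multiplication

/-! ### Abstract gauge element: construction and uniqueness. -/

section Gauge

variable {k : Type u} {H : Type v} [Field k] [Ring H] [Algebra k H]
variable {B : Type*} [Ring B] [Algebra k B] {Q : QuasiHopfAlgebra k H}
variable {V : Type*} [AddCommGroup V] [Module k V] {W : Type*} [AddCommGroup W] [Module k W]

theorem cv_covector_left {π : V →ₗ[k] W} {e g : H →ₐ[k] Module.End k V} (c : Com e g)
    (he : ∀ x v, π (e x v) = Q.counit x • π v) (x : H) (v : V) :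
    π (Q.cv e g x v) = π (g x v) := by
  have key : ∀ t, π (ev2 e g t v) = π (ev2 (Q.triv _) g t v) := by
    intro t
    induction t with
    | zero => simp
    | add x y hx hy => simp only [map_add, LinearMap.add_apply, hx, hy]
    | tmul x y => simp only [ev2_tmul, Module.End.mul_apply, he, triv_end_apply, map_smul]
  rw [cv_apply c, key, ← cv_apply (com_triv_left g), cv_triv_left]

variable (Q) in
/-- The linear map `m ⊗ n ↦ F(m α) n`. -/
def gaugeMap (F : H →ₐ[k] B) : H ⊗[k] B →ₗ[k] B :=
  LinearMap.mul' k B ∘ₗ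
    TensorProduct.map (F.toLinearMap ∘ₗ LinearMap.mulRight k Q.alpha) LinearMap.id

@[simp]
theorem gaugeMap_tmul (F : H →ₐ[k] B) (m : H) (n : B) :
    Q.gaugeMap F (m ⊗ₜ n) = F (m * Q.alpha) * n := rfl

variable (Q) in
/-- The element `F(S(φ̄₁) α φ̄₂) b G(φ̄₃)`. -/
def gauge (F : H →ₐ[k] B) (G : H →ₐ[k] Bᵐᵒᵖ) (b : B) : B :=
  Q.gaugeMap F (((Q.ph (onL B (rm (Q.anti (AlgHom.id k H)))) (onR H (lm F)) (onR H (rm G)))⁻¹ :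
    (Module.End k (H ⊗[k] B))ˣ).val (1 ⊗ₜ b))

theorem com3_gauge (F : H →ₐ[k] B) (G : H →ₐ[k] Bᵐᵒᵖ) :
    Com3 (onL B (rm (Q.anti (AlgHom.id k H)))) (onR H (lm F)) (onR H (rm G)) :=
  ⟨com_onL_onR _ _, com_onL_onR _ _, com_onR (com_lm_rm _ _)⟩

/-- The axiom for `α`, as invariance of a covector. -/
theorem gaugeMap_cv (F : H →ₐ[k] B) (x : H) (t : H ⊗[k] B) :
    Q.gaugeMap F (Q.cv (onL B (rm (Q.anti (AlgHom.id k H)))) (onR H (lm F)) x t) =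
      Q.counit x • Q.gaugeMap F t := by
  induction t with
  | zero => simp
  | add x y hx hy => simp only [map_add, smul_add, hx, hy]
  | tmul m n =>
    have key : ∀ s, Q.gaugeMap F (ev2 (onL B (rm (Q.anti (AlgHom.id k H)))) (onR H (lm F)) s
        (m ⊗ₜ n)) = F (m * antiLeft Q.antipode Q.alpha s) * n := by
      intro s
      induction s with
      | zero => simp
      | add x y hx hy => simp only [map_add, LinearMap.add_apply, mul_add, add_mul, hx, hy]
      | tmul x y => simp [mul_assoc, S]
    rw [cv_apply (com_onL_onR _ _), key, Q.antipode_alpha]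
    simp

/-- The axiom for `β`, as invariance of a vector. The factor `m` leaves room for `β` in other legs.
-/
theorem cv_lm_rm_anti_beta (a : H →ₐ[k] B) {m : B} (hm : ∀ x, Commute m (a x)) (x : H) :
    Q.cv (lm a) (rm (Q.anti a)) x (m * a Q.beta) = Q.counit x • (m * a Q.beta) := by
  have key : ∀ s, ev2 (lm a) (rm (Q.anti a)) s (m * a Q.beta) =
      m * a (antiRight Q.antipode Q.beta s) := by
    intro s
    induction s with
    | zero => simp
    | add x y hx hy => simp only [map_add, LinearMap.add_apply, mul_add, hx, hy]
    | tmul x y =>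
      simp only [ev2_tmul, Module.End.mul_apply, rm_apply, lm_apply, unop_anti, antiRight_tmul,
        map_mul, ← mul_assoc, (hm x).eq]
      rfl
  rw [cv_apply (com_lm_rm _ _), key, Q.antipode_beta]
  simp

/-- Since `b` is invariant, `h` acts on `1 ⊗ b` through all three legs, bracketed to the right, as
multiplication by `S(h)` on the first factor. Moving `h` across `φ⁻¹` brackets the legs to the left;
the covector absorbs the first two by the axiom for `α`, and only `G(h)` survives. -/
theorem gauge_antipode {F : H →ₐ[k] B} {G : H →ₐ[k] Bᵐᵒᵖ} {b : B}
    (hb : ∀ h, Q.cv (lm F) (rm G) h b = Q.counit h • b) (h : H) :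
    F (Q.S h) * Q.gauge F G b = Q.gauge F G b * (G h).unop := by
  have c := com3_gauge (Q := Q) F G
  have h₁ : ∀ t, F (Q.S h) * Q.gaugeMap F t =
      Q.gaugeMap F (onL B (lm (AlgHom.id k H)) (Q.S h) t) := by
    intro t
    induction t with
    | zero => simp
    | add x y hx hy => simp only [map_add, mul_add, hx, hy]
    | tmul m n => simp [mul_assoc]
  have h₂ : ∀ t, Q.gaugeMap F t * (G h).unop = Q.gaugeMap F (onR H (rm G) h t) := by
    intro t
    induction t with
    | zero => simp
    | add x y hx hy => simp only [map_add, add_mul, hx, hy]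
    | tmul m n => simp [mul_assoc]
  have h₃ := commute_ph (Q := Q) (b := onL B (lm (AlgHom.id k H)) (Q.S h)) c
    (fun y => com_onL (com_lm_rm _ _) (Q.S h) y) (fun y => com_onL_onR _ _ _ y)
    (fun y => com_onL_onR _ _ _ y)
  have h₄ : onL B (lm (AlgHom.id k H)) (Q.S h) ((1 : H) ⊗ₜ b) =
      Q.cv (onL B (rm (Q.anti (AlgHom.id k H)))) (Q.cv (onR H (lm F)) (onR H (rm G))) h
        ((1 : H) ⊗ₜ b) := by
    rw [cv_apply_congr_right (g' := Q.triv _) (com_cv_right c.1 c.2) (com_triv_right _),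
      cv_triv_right]
    · simp
    · intro x
      rw [cv_onR (com_lm_rm _ _), onR_tmul, hb, triv_end_apply, TensorProduct.tmul_smul]
  rw [gauge, h₁, h₂, ← cv_covector_left (com_cv_left c.2 c.3) (gaugeMap_cv F),
    ← Module.End.mul_apply, ← Module.End.mul_apply, h₃.units_inv_right.eq, Module.End.mul_apply,
    h₄, ← Module.End.mul_apply, (ph_semiconj_cv c h).units_inv_symm_left.eq]

/-- The pentagon is applied to `β ⊗ b`. Both associators on its left side fix this vector, one by
invariance of `β` and one by invariance of `b`. On the right, the covector removes the middle
associator, and what is left is `φ₁ β S(φ₂) α φ₃ = 1`. -/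
theorem gauge_beta {F : H →ₐ[k] B} {G : H →ₐ[k] Bᵐᵒᵖ} {b : B}
    (hb : ∀ h, Q.cv (lm F) (rm G) h b = Q.counit h • b) :
    F Q.beta * Q.gauge F G b = b := by
  have c := com3_gauge (Q := Q) F G
  have h12 : Com (onL B (lm (AlgHom.id k H))) (onL B (rm (Q.anti (AlgHom.id k H)))) :=
    com_onL (com_lm_rm _ _)
  have h13 : Com (onL B (lm (AlgHom.id k H))) (onR H (lm F)) := com_onL_onR _ _
  have h14 : Com (onL B (lm (AlgHom.id k H))) (onR H (rm G)) := com_onL_onR _ _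
  have h₁ : ∀ t, F Q.beta * Q.gaugeMap F t =
      Q.gaugeMap F (onL B (lm (AlgHom.id k H)) Q.beta t) := by
    intro t
    induction t with
    | zero => simp
    | add x y hx hy => simp only [map_add, mul_add, hx, hy]
    | tmul m n => simp [mul_assoc]
  have h₃ := commute_ph (Q := Q) (b := onL B (lm (AlgHom.id k H)) Q.beta) c
    (fun y => h12 _ y) (fun y => h13 _ y) (fun y => h14 _ y)
  have e := congrArg (fun p : (Module.End k (H ⊗[k] B))ˣ => p.val (Q.beta ⊗ₜ[k] b))
    (ph_pentagon (Q := Q) h12 h13 h14 c.1 c.2 c.3)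
  simp only [Units.val_mul, Module.End.mul_apply] at e
  rw [ph_apply_left ⟨com_cv_left h13 c.1, com_cv_left h14 c.2, c.3⟩,
    ph_apply_right ⟨h12, com_cv_right h13 h14, com_cv_right c.1 c.2⟩] at e
  · have key : ∀ t, Q.gaugeMap F (ev3 (onL B (lm (AlgHom.id k H)))
        (onL B (rm (Q.anti (AlgHom.id k H)))) (onR H (lm F)) t (Q.beta ⊗ₜ b)) =
        F ((LinearMap.mul' k H ∘ₗ TensorProduct.map (LinearMap.mulRight k Q.beta)
          (antiLeft Q.antipode Q.alpha)) t) * b := by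
      intro t
      induction t with
      | zero => simp
      | add x y hx hy => simp only [map_add, LinearMap.add_apply, add_mul, hx, hy]
      | tmul x t =>
        induction t with
        | zero => simp
        | add y z hy hz =>
          simp only [map_add, TensorProduct.tmul_add, LinearMap.add_apply, add_mul, hy, hz]
        | tmul y z => simp [mul_assoc, S]
    rw [gauge, h₁, ← Module.End.mul_apply, h₃.units_inv_right.eq, Module.End.mul_apply, onL_tmul,
      lm_apply, AlgHom.id_apply, mul_one, units_inv_apply e.symm,
      ph_covector_mid ⟨com_cv_right h12 h13, h14, com_cv_left c.2 c.3⟩ (gaugeMap_cv F),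
      coe_ph h12 h13 c.1, key, Q.phi_antipode, map_one, one_mul]
  · intro x
    rw [cv_onR (com_lm_rm _ _), onR_tmul, hb, TensorProduct.tmul_smul]
  · intro x
    have key := cv_lm_rm_anti_beta (Q := Q) (AlgHom.id k H) (m := 1) (fun _ => Commute.one_left _) x
    rw [one_mul, AlgHom.id_apply] at key
    have e := (intertwines_cv (Q := Q) (π := (TensorProduct.mk k H B).flip b)
      (com_lm_rm (AlgHom.id k H) (Q.anti (AlgHom.id k H))) h12 (fun _ _ => rfl) (fun _ _ => rfl)) x
      Q.beta
    rw [key] at e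
    simpa using e.symm

/-- Expand `1 = S(φ̄₁) α φ̄₂ β S(φ̄₃)` in front of `v`: `F(S(φ̄₃))` passes through `v` and becomes
`G(φ̄₃)`, so `v` depends only on `F(β) v`. -/
theorem gauge_unique {F : H →ₐ[k] B} {G : H →ₐ[k] Bᵐᵒᵖ} {v w : B}
    (hv : ∀ h, F (Q.S h) * v = v * (G h).unop) (hw : ∀ h, F (Q.S h) * w = w * (G h).unop)
    (e : F Q.beta * v = F Q.beta * w) : v = w := by
  have key : ∀ t, F ((LinearMap.mul' k H ∘ₗ
      TensorProduct.map (LinearMap.mulRight k Q.alpha ∘ₗ antiLin Q.antipode)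
        (antiRight Q.antipode Q.beta)) t) * v = F ((LinearMap.mul' k H ∘ₗ
      TensorProduct.map (LinearMap.mulRight k Q.alpha ∘ₗ antiLin Q.antipode)
        (antiRight Q.antipode Q.beta)) t) * w := by
    intro t
    induction t with
    | zero => simp
    | add x y hx hy => simp only [map_add, add_mul, hx, hy]
    | tmul x t =>
      induction t with
      | zero => simp
      | add y z hy hz => simp only [map_add, TensorProduct.tmul_add, add_mul, hy, hz]
      | tmul y z =>
        have hv' := hv z
        have hw' := hw z
        simp only [S, antiLin_apply] at hv' hw'
        simp only [LinearMap.comp_apply, TensorProduct.map_tmul, LinearMap.mulRight_apply,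
          antiLin_apply, antiRight_tmul, LinearMap.mul'_apply, map_mul, mul_assoc, hv', hw']
        rw [← mul_assoc (F Q.beta), e, mul_assoc]
  simpa [Q.phiInv_antipode] using key Q.phi⁻¹.val

end Gauge

end QuasiHopfAlgebra

namespace QuasiHopfAlgebra

/-! ### The inverse Drinfeld twist as a gauge element. -/

section Twist

variable {k : Type u} {H : Type v} [Field k] [Ring H] [Algebra k H]
variable {B : Type*} [Ring B] [Algebra k B] {Q : QuasiHopfAlgebra k H}
variable {V : Type*} [AddCommGroup V] [Module k V]

theorem pairwise_four_iff {f g h i : H →ₐ[k] B} : [f, g, h, i].Pairwise Com ↔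
    (Com f g ∧ Com f h ∧ Com f i) ∧ (Com g h ∧ Com g i) ∧ Com h i := by
  simp

theorem ev4_tensorOne (f g h i : H →ₐ[k] B) (t : H ⊗[k] (H ⊗[k] H)) :
    ev4 f g h i (tensorOne t) = ev3 f g h t := by
  rw [tensorOne, ev4, mulMap_map, ev3]
  congr 2
  ext x y
  simp

theorem ev4_comulFst {f g h i : H →ₐ[k] B} (hfg : Com f g) (t : H ⊗[k] (H ⊗[k] H)) :
    ev4 f g h i (comulFst Q.comul (H ⊗[k] H) t) = ev3 (Q.cv f g) h i t :=
  (mulMap_cv hfg _ t).symm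

theorem coe_theta {f g h i : H →ₐ[k] B} (c : [f, g, h, i].Pairwise Com) :
    (Q.theta f g h i : B) =
      ev4 f g h i (comulFst Q.comul (H ⊗[k] H) Q.phi * tensorOne Q.phiInv) := by
  obtain ⟨⟨h01, h02, h03⟩, ⟨h12, h13⟩, h23⟩ := pairwise_four_iff.mp c
  rw [ev4_mul h01 h02 h03 h12 h13 h23, ev4_tensorOne, ev4_comulFst h01, theta, Units.val_mul,
    coe_ph (com_cv_left h02 h12) (com_cv_left h03 h13) h23, coe_ph_inv h01 h02 h12]

theorem coe_theta_inv {f g h i : H →ₐ[k] B} (c : [f, g, h, i].Pairwise Com) :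
    ((Q.theta f g h i)⁻¹ : Bˣ) = ev4 f g h i Q.chi := by
  obtain ⟨⟨h01, h02, h03⟩, ⟨h12, h13⟩, h23⟩ := pairwise_four_iff.mp c
  rw [chi, ev4_mul h01 h02 h03 h12 h13 h23, ev4_tensorOne, ev4_comulFst h01, theta, mul_inv_rev,
    inv_inv, Units.val_mul, coe_ph_inv (com_cv_left h02 h12) (com_cv_left h03 h13) h23,
    coe_ph h01 h02 h12]

/-- The two factors of `theta` rebracket in turn, passing through `((fg)h)i`. -/
theorem theta_semiconj {f g h i : H →ₐ[k] B} (c : [f, g, h, i].Pairwise Com) (x : H) :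
    SemiconjBy (Q.theta f g h i : B) (Q.cv (Q.cv f (Q.cv g h)) i x)
      (Q.cv (Q.cv f g) (Q.cv h i) x) := by
  obtain ⟨⟨h01, h02, h03⟩, ⟨h12, h13⟩, h23⟩ := pairwise_four_iff.mp c
  have d : Com3 f g h := ⟨h01, h02, h12⟩
  refine SemiconjBy.mul_left (ph_semiconj_cv ?_ x) (SemiconjBy.units_inv_symm_left ?_)
  · exact ⟨com_cv_left h02 h12, com_cv_left h03 h13, h23⟩
  · refine semiconj_cv ?_ ?_ (ph_semiconj_cv d) (fun x => ?_) x
    · apply_rules [com_cv_left, com_cv_right]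
    · apply_rules [com_cv_left, com_cv_right]
    · exact (commute_ph d (h03.symm x) (h13.symm x) (h23.symm x)).symm

theorem commute_theta {f g h i : H →ₐ[k] B} {b : B} (c : [f, g, h, i].Pairwise Com)
    (hf : ∀ x, Commute b (f x)) (hg : ∀ x, Commute b (g x)) (hh : ∀ x, Commute b (h x))
    (hi : ∀ x, Commute b (i x)) : Commute b (Q.theta f g h i : B) := by
  obtain ⟨⟨h01, h02, h03⟩, ⟨h12, h13⟩, h23⟩ := pairwise_four_iff.mp c
  rw [theta, Units.val_mul]
  exact (commute_ph ⟨com_cv_left h02 h12, com_cv_left h03 h13, h23⟩ (commute_cv hf hg) hh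
    hi).mul_right (commute_ph ⟨h01, h02, h12⟩ hf hg hh).units_inv_right

/-- For nested pairs of legs, the inner pair can be deleted by invariance of `v`, after which the
outer pair acts trivially as well; `theta_semiconj` transports this to the bracketing `(fg)(hi)`. It
gives the invariance of `b` from that of `β` in each leg. -/
theorem cv_theta_apply {f g h i : H →ₐ[k] Module.End k V} {v : V}
    (c : [f, g, h, i].Pairwise Com) (hgh : ∀ x, Q.cv g h x v = Q.counit x • v)
    (hfi : ∀ x, Q.cv f i x v = Q.counit x • v) (x : H) :
    Q.cv (Q.cv f g) (Q.cv h i) x ((Q.theta f g h i : Module.End k V) v) =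
      Q.counit x • (Q.theta f g h i : Module.End k V) v := by
  obtain ⟨⟨h01, h02, h03⟩, ⟨h12, h13⟩, h23⟩ := pairwise_four_iff.mp c
  rw [← Module.End.mul_apply, ← (theta_semiconj c x).eq, Module.End.mul_apply,
    cv_apply_congr_left (f' := f) (com_cv_left h03 (com_cv_left h13 h23)) h03, hfi, map_smul]
  intro y
  rw [cv_apply_congr_right (g' := Q.triv _) (com_cv_right h01 h02) (com_triv_right _),
    cv_triv_right]
  exact fun z => (hgh z).trans (triv_end_apply z v).symm

theorem pairwise_legs {a₁ a₂ : H →ₐ[k] B} (h : Com a₁ a₂) :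
    [lm a₁, lm a₂, rm (Q.anti a₂), rm (Q.anti a₁)].Pairwise Com :=
  pairwise_four_iff.mpr ⟨⟨com_lm h, com_lm_rm _ _, com_lm_rm _ _⟩,
    ⟨com_lm_rm _ _, com_lm_rm _ _⟩, com_rm (com_anti h.symm)⟩

theorem ev2_outerInner {a₁ a₂ : H →ₐ[k] B} (h : Com a₁ a₂)
    (t : H ⊗[k] (H ⊗[k] (H ⊗[k] H))) :
    ev2 a₁ a₂ (TensorProduct.map (antiRight Q.antipode Q.beta) (antiRight Q.antipode Q.beta)
      (outerInner k H t)) = ev4 (lm a₁) (lm a₂) (rm (Q.anti a₂)) (rm (Q.anti a₁)) t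
        (a₁ Q.beta * a₂ Q.beta) := by
  induction t with
  | zero => simp
  | add x y hx hy => simp only [map_add, LinearMap.add_apply, hx, hy]
  | tmul x t =>
    induction t with
    | zero => simp
    | add y z hy hz => simp only [map_add, TensorProduct.tmul_add, LinearMap.add_apply, hy, hz]
    | tmul y t =>
      induction t with
      | zero => simp
      | add z w hz hw =>
        simp only [map_add, TensorProduct.tmul_add, LinearMap.add_apply, hz, hw]
      | tmul z w =>
        have e₁ := (h (Q.S w) (y * Q.beta)).eq
        have e₂ := (h Q.beta y).eq
        simp only [map_mul] at e₁
        simp only [outerInner_tmul, TensorProduct.map_tmul, antiRight_tmul, ev2_tmul, ev3_tmul,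
          ev4_tmul, map_mul, Module.End.mul_apply, rm_apply, unop_anti, lm_apply, mul_assoc]
        simp only [S, antiLin_apply] at e₁ ⊢
        congr 1
        rw [← mul_assoc (a₂ y) (a₂ Q.beta), ← mul_assoc (a₁ _) (a₂ y * a₂ Q.beta), e₁]
        simp only [mul_assoc]
        rw [← mul_assoc (a₁ Q.beta) (a₂ y), e₂, mul_assoc]

theorem ev2_twistB {a₁ a₂ : H →ₐ[k] B} (h : Com a₁ a₂) :
    ev2 a₁ a₂ Q.twistB =
      (Q.theta (lm a₁) (lm a₂) (rm (Q.anti a₂)) (rm (Q.anti a₁)) : Module.End k B)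
        (a₁ Q.beta * a₂ Q.beta) := by
  rw [twistB, ev2_outerInner h, coe_theta (pairwise_legs h)]

theorem cv_twistB {a₁ a₂ : H →ₐ[k] B} (h : Com a₁ a₂) (x : H) :
    Q.cv (lm (Q.cv a₁ a₂)) (rm (Q.cv (Q.anti a₂) (Q.anti a₁))) x (ev2 a₁ a₂ Q.twistB) =
      Q.counit x • ev2 a₁ a₂ Q.twistB := by
  rw [ev2_twistB h, ← cv_lm h, ← cv_rm (com_anti h.symm)]
  refine cv_theta_apply (pairwise_legs h) ?_ ?_ x
  · exact cv_lm_rm_anti_beta a₂ (fun x => h _ x)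
  · rw [(h Q.beta Q.beta).eq]
    exact cv_lm_rm_anti_beta a₁ (fun x => (h x _).symm)

theorem unop_cv_anti {a₁ a₂ : H →ₐ[k] B} (h : Com a₁ a₂) (x : H) :
    (Q.cv (Q.anti a₂) (Q.anti a₁) x).unop = ev2 a₁ a₂ (Q.antipodeCop x) := by
  rw [cv_apply (com_anti h.symm), antipodeCop, LinearMap.comp_apply, LinearMap.comp_apply]
  simp only [AlgHom.toLinearMap_apply]
  generalize Q.comul x = t
  induction t with
  | zero => simp
  | add x y hx hy => simp only [map_add, MulOpposite.unop_add, hx, hy]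
  | tmul x y => simp

theorem com_include : Com (Algebra.TensorProduct.includeLeft : H →ₐ[k] H ⊗[k] H)
    Algebra.TensorProduct.includeRight := fun x y => by
  simp [Commute, SemiconjBy]

theorem ev2_include (t : H ⊗[k] H) : ev2 (Algebra.TensorProduct.includeLeft : H →ₐ[k] H ⊗[k] H)
    Algebra.TensorProduct.includeRight t = t := by
  induction t with
  | zero => simp
  | add x y hx hy => simp only [map_add, hx, hy]
  | tmul x y => simp

theorem cv_include : Q.cv (Algebra.TensorProduct.includeLeft : H →ₐ[k] H ⊗[k] H)
    Algebra.TensorProduct.includeRight = Q.comul :=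
  AlgHom.ext fun x => by rw [cv_apply com_include, ev2_include]

/-- This makes `gauge_antipode` and `gauge_beta` available for `f⁻¹`, in the universal case `B = H ⊗
H`. -/
theorem twistInv_eq_gauge : Q.twistInv = Q.gauge Q.comul
    (Q.cv (Q.anti Algebra.TensorProduct.includeRight) (Q.anti Algebra.TensorProduct.includeLeft))
      Q.twistB := by
  have c := com3_gauge (Q := Q) Q.comul
    (Q.cv (Q.anti Algebra.TensorProduct.includeRight) (Q.anti Algebra.TensorProduct.includeLeft))
  rw [gauge, c.coe_ph_inv, twistInv, qL]
  generalize Q.phiInv = t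
  induction t with
  | zero => simp
  | add x y hx hy => simp only [map_add, LinearMap.add_apply, hx, hy]
  | tmul x t =>
    induction t with
    | zero => simp
    | add y z hy hz => simp only [map_add, TensorProduct.tmul_add, LinearMap.add_apply, hy, hz]
    | tmul y z =>
      simp only [TensorProduct.assoc_symm_tmul, TensorProduct.map_tmul, LinearMap.comp_apply,
        ev3_tmul, ev2_tmul, Module.End.mul_apply, onR_tmul, onL_tmul, rm_apply, lm_apply,
        unop_cv_anti com_include, ev2_include, gaugeMap_tmul, one_mul, unop_anti,
        AlgHom.id_apply, antiLeft_tmul, LinearMap.id_apply, LinearMap.mul'_apply,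
        LinearMap.mulRight_apply, AlgHom.toLinearMap_apply, map_mul, mul_assoc]
      rfl

variable (Q) in
/-- The image of `f⁻¹` under `x ⊗ y ↦ a₁(x) a₂(y)`. -/
def tw (a₁ a₂ : H →ₐ[k] B) : B := ev2 a₁ a₂ Q.twistInv

/-- Image of the universal identity in `H ⊗ H` under `a₁ ⊗ a₂`. Together with `tw_beta` it
determines `tw a₁ a₂`, by `gauge_unique`. -/
theorem tw_antipode {a₁ a₂ : H →ₐ[k] B} (h : Com a₁ a₂) (x : H) :
    Q.cv a₁ a₂ (Q.S x) * Q.tw a₁ a₂ =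
      Q.tw a₁ a₂ * (Q.cv (Q.anti a₂) (Q.anti a₁) x).unop := by
  have hb := cv_twistB (Q := Q) com_include
  rw [cv_include, ev2_include] at hb
  have e := congrArg (ev2 a₁ a₂) (gauge_antipode hb x)
  rw [← twistInv_eq_gauge, ev2_mul h, ev2_mul h, unop_cv_anti com_include, ev2_include] at e
  rw [cv_apply h, unop_cv_anti h]
  exact e

theorem tw_beta {a₁ a₂ : H →ₐ[k] B} (h : Com a₁ a₂) :
    Q.cv a₁ a₂ Q.beta * Q.tw a₁ a₂ =
      (Q.theta (lm a₁) (lm a₂) (rm (Q.anti a₂)) (rm (Q.anti a₁)) : Module.End k B)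
        (a₁ Q.beta * a₂ Q.beta) := by
  have hb := cv_twistB (Q := Q) com_include
  rw [cv_include, ev2_include] at hb
  have e := congrArg (ev2 a₁ a₂) (gauge_beta hb)
  rw [← twistInv_eq_gauge, ev2_mul h, ev2_twistB h] at e
  rw [cv_apply h]
  exact e

end Twist

end QuasiHopfAlgebra

namespace QuasiHopfAlgebra

/-! ### Compatibility of the twist with the associator. -/

section TwistCoherence

variable {k : Type u} {H : Type v} [Field k] [Ring H] [Algebra k H]
variable {B : Type*} [Ring B] [Algebra k B] {Q : QuasiHopfAlgebra k H}
variable {V : Type*} [AddCommGroup V] [Module k V]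

/-- The leg `e` commutes with all the others, so it still acts by `ε` on every vector obtained from
`w` along the way. It can therefore be deleted from each associator in turn. -/
theorem theta_insert {f g e h i : H →ₐ[k] Module.End k V} {w : V}
    (c : [f, g, e, h, i].Pairwise Com) (he : ∀ x, e x w = Q.counit x • w) :
    ((Q.ph f g e)⁻¹ : (Module.End k V)ˣ).val ((Q.theta f (Q.cv g e) h i).val w) =
      (Q.theta f g h i).val w := by
  simp only [List.pairwise_cons, List.mem_cons, List.not_mem_nil, or_false, forall_eq_or_imp,
    forall_eq, IsEmpty.forall_iff, implies_true, List.Pairwise.nil, and_true] at c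
  obtain ⟨⟨h01, h02, h03, h04⟩, ⟨h12, h13, h14⟩, ⟨h23, h24⟩, h34⟩ := c
  have kill : ∀ {p : Module.End k V}, (∀ x, Commute p (e x)) → ∀ {v : V},
      (∀ x, e x v = Q.counit x • v) → ∀ x, e x (p v) = Q.counit x • p v := by
    intro p hp v hv x
    rw [← Module.End.mul_apply, ← (hp x).eq, Module.End.mul_apply, hv, map_smul]
  have hge : ∀ {v : V}, (∀ x, e x v = Q.counit x • v) → ∀ x, Q.cv g e x v = g x v := by
    intro v hv x
    rw [cv_apply_congr_right (g' := Q.triv _) h12 (com_triv_right _), cv_triv_right]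
    exact fun z => (hv z).trans (triv_end_apply z v).symm
  have e₁ : ((Q.ph f (Q.cv g e) h)⁻¹ : (Module.End k V)ˣ).val w =
      ((Q.ph f g h)⁻¹ : (Module.End k V)ˣ).val w := by
    rw [coe_ph_inv (com_cv_right h01 h02) h03 (com_cv_left h13 h23), coe_ph_inv h01 h03 h13,
      ev3_apply_congr_mid (com_cv_left h13 h23) h13 (hge he)]
  have k₁ : ∀ x, e x (((Q.ph f g h)⁻¹ : (Module.End k V)ˣ).val w) =
      Q.counit x • ((Q.ph f g h)⁻¹ : (Module.End k V)ˣ).val w :=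
    kill (fun x => (commute_ph ⟨h01, h03, h13⟩ (h02.symm x) (h12.symm x)
      (h23 x)).units_inv_right.symm) he
  have e₂ : (Q.theta f (Q.cv g e) h i).val w = (Q.theta f g h i).val w := by
    rw [theta, theta, Units.val_mul, Units.val_mul, Module.End.mul_apply, Module.End.mul_apply, e₁,
      coe_ph (com_cv_left h03 (com_cv_left h13 h23)) (com_cv_left h04 (com_cv_left h14 h24)) h34,
      coe_ph (com_cv_left h03 h13) (com_cv_left h04 h14) h34,
      ev3_apply_congr_left (com_cv_left h03 (com_cv_left h13 h23)) (com_cv_left h03 h13)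
        (com_cv_left h04 (com_cv_left h14 h24)) (com_cv_left h04 h14)
        (cv_apply_congr_right (com_cv_right h01 h02) h01 (hge k₁))]
  rw [e₂]
  refine units_inv_apply (ph_apply_right ⟨h01, h02, h12⟩ ?_)
  exact kill (fun x => (commute_theta (pairwise_four_iff.mpr ⟨⟨h01, h03, h04⟩, ⟨h13, h14⟩, h34⟩)
    (h02.symm x) (h12.symm x) (h23 x) (h24 x)).symm) he

theorem ev3_lm (f g h : H →ₐ[k] B) (t : H ⊗[k] (H ⊗[k] H)) (b : B) :
    ev3 (lm f) (lm g) (lm h) t b = ev3 f g h t * b := by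
  induction t with
  | zero => simp
  | add x y hx hy => simp only [map_add, LinearMap.add_apply, add_mul, hx, hy]
  | tmul x y => simp [mul_assoc, ev2_lm]

theorem ph_lm {f g h : H →ₐ[k] B} (c : Com3 f g h) (b : B) :
    (Q.ph (lm f) (lm g) (lm h) : Module.End k B) b = (Q.ph f g h : B) * b := by
  rw [coe_ph (com_lm c.1) (com_lm c.2) (com_lm c.3), ev3_lm, c.coe_ph]

theorem commute_tw {a₁ a₂ : H →ₐ[k] B} {b : B} (h₁ : ∀ x, Commute b (a₁ x))
    (h₂ : ∀ x, Commute b (a₂ x)) : Commute b (Q.tw a₁ a₂) := commute_ev2 h₁ h₂ _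

theorem semiconj_op_tw {a₁ a₂ : H →ₐ[k] B} (h : Com a₁ a₂) (x : H) :
    SemiconjBy (MulOpposite.op (Q.tw a₁ a₂)) (Q.anti (Q.cv a₁ a₂) x)
      (Q.cv (Q.anti a₂) (Q.anti a₁) x) :=
  MulOpposite.unop_injective (tw_antipode h x)

theorem commute_op_tw {a₁ a₂ a₃ : H →ₐ[k] B} (h₁ : Com a₃ a₁) (h₂ : Com a₃ a₂) (x : H) :
    Commute (MulOpposite.op (Q.tw a₁ a₂)) (Q.anti a₃ x) :=
  MulOpposite.unop_injective (commute_tw (h₁ _) (h₂ _)).eq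

theorem intertwines_rm_tw {a₁ a₂ : H →ₐ[k] B} (h : Com a₁ a₂) :
    Intertwines (LinearMap.mulRight k (Q.tw a₁ a₂)) (rm (Q.anti (Q.cv a₁ a₂)))
      (rm (Q.cv (Q.anti a₂) (Q.anti a₁))) := fun x v => by
  simp only [rm_apply, LinearMap.mulRight_apply, unop_anti, mul_assoc, tw_antipode h]

theorem intertwines_mulRight_lm (b : B) (f : H →ₐ[k] B) :
    Intertwines (LinearMap.mulRight k b) (lm f) (lm f) := fun x v => by
  simp [mul_assoc]

theorem intertwines_mulRight_rm {b : B} {f : H →ₐ[k] B} (h : ∀ x, Commute b (f x)) :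
    Intertwines (LinearMap.mulRight k b) (rm (Q.anti f)) (rm (Q.anti f)) := fun x v => by
  simp [mul_assoc, (h _).eq]

theorem intertwines_mulLeft_rm (b : B) (f : H →ₐ[k] Bᵐᵒᵖ) :
    Intertwines (LinearMap.mulLeft k b) (rm f) (rm f) := fun x v => by
  simp [mul_assoc]

theorem intertwines_mulLeft_lm {b : B} {f : H →ₐ[k] B} (h : ∀ x, Commute b (f x)) :
    Intertwines (LinearMap.mulLeft k b) (lm f) (lm f) := fun x v => by
  simp [← mul_assoc, (h _).eq]

theorem pairwise_six {a₁ a₂ a₃ : H →ₐ[k] B} (c : Com3 a₁ a₂ a₃) :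
    [lm a₁, lm a₂, lm a₃, rm (Q.anti a₃), rm (Q.anti a₂), rm (Q.anti a₁)].Pairwise Com := by
  simp only [List.pairwise_cons, List.mem_cons, List.not_mem_nil, or_false, forall_eq_or_imp,
    forall_eq, IsEmpty.forall_iff, implies_true, List.Pairwise.nil, and_true]
  exact ⟨⟨com_lm c.1, com_lm c.2, com_lm_rm _ _, com_lm_rm _ _, com_lm_rm _ _⟩,
    ⟨com_lm c.3, com_lm_rm _ _, com_lm_rm _ _, com_lm_rm _ _⟩,
    ⟨com_lm_rm _ _, com_lm_rm _ _, com_lm_rm _ _⟩,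
    ⟨com_rm (com_anti c.3.symm), com_rm (com_anti c.2.symm)⟩, com_rm (com_anti c.1.symm)⟩

/-- `tw_beta` is used for the pair `a₁a₂, a₃` and then for `a₁, a₂`. Right multiplication by `tw a₁
a₂` splits the antipode leg of `a₁a₂` into the antipode legs of `a₂` and `a₁`. -/
theorem tw_beta_left {a₁ a₂ a₃ : H →ₐ[k] B} (c : Com3 a₁ a₂ a₃) :
    Q.cv (Q.cv a₁ a₂) a₃ Q.beta * Q.tw (Q.cv a₁ a₂) a₃ * Q.tw a₁ a₂ =
      (Q.theta (Q.cv (lm a₁) (lm a₂)) (lm a₃) (rm (Q.anti a₃))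
        (Q.cv (rm (Q.anti a₂)) (rm (Q.anti a₁)))).val
        ((Q.theta (lm a₁) (lm a₂) (rm (Q.anti a₂)) (rm (Q.anti a₁))).val
          (a₁ Q.beta * a₂ Q.beta * a₃ Q.beta)) := by
  have c' : Com (Q.cv a₁ a₂) a₃ := com_cv_left c.2 c.3
  have e₁ := intertwines_theta (Q := Q) (π := LinearMap.mulRight k (Q.tw a₁ a₂))
    (pairwise_legs (Q := Q) c')
    (g' := lm a₃) (h' := rm (Q.anti a₃)) (f' := lm (Q.cv a₁ a₂))
    (i' := rm (Q.cv (Q.anti a₂) (Q.anti a₁)))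
    (pairwise_four_iff.mpr ⟨⟨com_lm c', com_lm_rm _ _, com_lm_rm _ _⟩,
      ⟨com_lm_rm _ _, com_lm_rm _ _⟩,
      com_rm (com_cv_right (com_anti c.3.symm) (com_anti c.2.symm))⟩)
    (intertwines_mulRight_lm _ _) (intertwines_mulRight_lm _ _)
    (intertwines_mulRight_rm fun x => (commute_tw (c.2.symm x) (c.3.symm x)).symm)
    (intertwines_rm_tw c.1) (Q.cv a₁ a₂ Q.beta * a₃ Q.beta)
  have e₂ := intertwines_theta (Q := Q) (π := LinearMap.mulRight k (a₃ Q.beta))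
    (pairwise_legs (Q := Q) c.1) (pairwise_legs (Q := Q) c.1)
    (intertwines_mulRight_lm _ _) (intertwines_mulRight_lm _ _)
    (intertwines_mulRight_rm (c.3.symm _)) (intertwines_mulRight_rm (c.2.symm _))
    (a₁ Q.beta * a₂ Q.beta)
  rw [← tw_beta c'] at e₁
  rw [← tw_beta c.1] at e₂
  simp only [LinearMap.mulRight_apply] at e₁ e₂
  rw [e₁, ← e₂, cv_lm c.1, cv_rm (com_anti c.1.symm), mul_assoc, mul_assoc,
    (commute_tw (c.2.symm _) (c.3.symm _)).eq]

theorem tw_beta_right {a₁ a₂ a₃ : H →ₐ[k] B} (c : Com3 a₁ a₂ a₃) :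
    Q.cv a₁ (Q.cv a₂ a₃) Q.beta * Q.tw a₁ (Q.cv a₂ a₃) * Q.tw a₂ a₃ =
      (Q.theta (lm a₁) (Q.cv (lm a₂) (lm a₃)) (Q.cv (rm (Q.anti a₃)) (rm (Q.anti a₂)))
        (rm (Q.anti a₁))).val
        ((Q.theta (lm a₂) (lm a₃) (rm (Q.anti a₃)) (rm (Q.anti a₂))).val
          (a₁ Q.beta * a₂ Q.beta * a₃ Q.beta)) := by
  have c' : Com a₁ (Q.cv a₂ a₃) := com_cv_right c.1 c.2
  have e₁ := intertwines_theta (Q := Q) (π := LinearMap.mulRight k (Q.tw a₂ a₃))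
    (pairwise_legs (Q := Q) c')
    (g' := lm (Q.cv a₂ a₃)) (h' := rm (Q.cv (Q.anti a₃) (Q.anti a₂))) (f' := lm a₁)
    (i' := rm (Q.anti a₁))
    (pairwise_four_iff.mpr ⟨⟨com_lm c', com_lm_rm _ _, com_lm_rm _ _⟩,
      ⟨com_lm_rm _ _, com_lm_rm _ _⟩,
      com_rm (com_cv_left (com_anti c.2.symm) (com_anti c.1.symm))⟩)
    (intertwines_mulRight_lm _ _) (intertwines_mulRight_lm _ _)
    (intertwines_rm_tw c.3)
    (intertwines_mulRight_rm fun x => (commute_tw (c.1 x) (c.2 x)).symm)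
    (a₁ Q.beta * Q.cv a₂ a₃ Q.beta)
  have e₂ := intertwines_theta (Q := Q) (π := LinearMap.mulLeft k (a₁ Q.beta))
    (pairwise_legs (Q := Q) c.3) (pairwise_legs (Q := Q) c.3)
    (intertwines_mulLeft_lm (c.1 _)) (intertwines_mulLeft_lm (c.2 _))
    (intertwines_mulLeft_rm _ _) (intertwines_mulLeft_rm _ _)
    (a₂ Q.beta * a₃ Q.beta)
  rw [← tw_beta c'] at e₁
  rw [← tw_beta c.3] at e₂
  simp only [LinearMap.mulRight_apply, LinearMap.mulLeft_apply] at e₁ e₂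
  rw [e₁, mul_assoc (a₁ _), mul_assoc (a₁ _), ← e₂, cv_lm c.3, cv_rm (com_anti c.3.symm)]

/-- The compatibility of the inverse of Drinfeld's twist with the associator. -/
theorem tw_coherence {a₁ a₂ a₃ : H →ₐ[k] B} (c : Com3 a₁ a₂ a₃) :
    (Q.ph a₁ a₂ a₃).val * Q.tw (Q.cv a₁ a₂) a₃ * Q.tw a₁ a₂ =
      Q.tw a₁ (Q.cv a₂ a₃) * Q.tw a₂ a₃ *
        (Q.ph (Q.anti a₃) (Q.anti a₂) (Q.anti a₁)).val.unop := by
  have d : Com3 (Q.anti a₃) (Q.anti a₂) (Q.anti a₁) :=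
    ⟨com_anti c.3.symm, com_anti c.2.symm, com_anti c.1.symm⟩
  -- Both sides intertwine `S` on the product `a₁(a₂a₃)` with the reversed product of antipodes, so
  -- it is enough to compare them after multiplication by `β`.
  refine gauge_unique (Q := Q) (F := Q.cv a₁ (Q.cv a₂ a₃))
    (G := Q.cv (Q.anti a₃) (Q.cv (Q.anti a₂) (Q.anti a₁))) (fun x => ?_) (fun x => ?_) ?_
  · have s := (semiconj_cv (Q := Q) (com_anti (Q := Q) (com_cv_right c.2.symm c.3.symm))
      (com_cv_right d.1 d.2)
      (fun x => commute_op_tw c.2.symm c.3.symm x) (fun x => semiconj_op_tw c.1 x) x).eq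
    have s' := congrArg MulOpposite.unop s
    simp only [MulOpposite.unop_mul, MulOpposite.unop_op] at s'
    rw [← mul_assoc, ← mul_assoc, ← (ph_semiconj_cv c _).eq, mul_assoc (Q.ph a₁ a₂ a₃).val,
      tw_antipode (com_cv_left c.2 c.3), mul_assoc, mul_assoc, s']
    simp only [mul_assoc]
  · have s := (semiconj_cv (Q := Q) (com_anti (Q := Q) (com_cv_left c.1.symm c.2.symm))
      (com_cv_left d.2 d.3)
      (fun x => semiconj_op_tw c.3 x) (fun x => commute_op_tw c.1 c.2 x) x).eq
    have s' := congrArg MulOpposite.unop s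
    have s'' := congrArg MulOpposite.unop (ph_semiconj_cv (Q := Q) d x).eq
    simp only [MulOpposite.unop_mul, MulOpposite.unop_op] at s' s''
    rw [← mul_assoc, ← mul_assoc, tw_antipode (com_cv_right c.1 c.2), mul_assoc (Q.tw a₁ _), s',
      mul_assoc, mul_assoc, s'']
    simp only [mul_assoc]
  -- The six-leg coherence is evaluated at `β` in all three legs. The pair formed by `a₃` and its
  -- antipode acts trivially there, so `theta_insert` shortens the left side to the form of
  -- `tw_beta_left`; the right side has the form of `tw_beta_right`.
  · have e := congrArg (fun p : (Module.End k B)ˣ => p.val (a₁ Q.beta * a₂ Q.beta * a₃ Q.beta))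
      (theta_coherence (Q := Q) (pairwise_six (Q := Q) c))
    simp only [Units.val_mul, Module.End.mul_apply] at e
    rw [theta_insert] at e
    · rw [← mul_assoc, ← mul_assoc, ← (ph_semiconj_cv c _).eq, mul_assoc, mul_assoc,
        ← mul_assoc (Q.cv (Q.cv a₁ a₂) a₃ Q.beta), tw_beta_left c, ← ph_lm c, e, ph_rm d,
        ← tw_beta_right c]
      simp only [mul_assoc]
    · have h := pairwise_six (Q := Q) c
      simp only [List.pairwise_cons, List.mem_cons, List.not_mem_nil, or_false,
        forall_eq_or_imp, forall_eq, IsEmpty.forall_iff, implies_true, List.Pairwise.nil,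
        and_true] at h ⊢
      obtain ⟨⟨h01, h02, h03, h04, h05⟩, ⟨h12, h13, h14, h15⟩, ⟨h23, h24, h25⟩, ⟨h34, h35⟩, h45⟩ := h
      refine ⟨⟨?_, ?_, ?_, ?_⟩, ⟨?_, ?_, ?_⟩, ⟨?_, ?_⟩, ?_⟩ <;>
        apply_rules [com_cv_left, com_cv_right]
    · exact cv_lm_rm_anti_beta a₃ (fun x => ((c.2 _ x).mul_left (c.3 _ x)))

end TwistCoherence

end QuasiHopfAlgebra

namespace QuasiHopfAlgebra

/-! ### The induced action and `ω` in terms of legs. -/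

section Induced

variable {k : Type u} {H : Type v} [Field k] [Ring H] [Algebra k H]
variable {Q : QuasiHopfAlgebra k H}
variable {V : Type w} [AddCommGroup V] [Module k V]

variable (k H) in
/-- Left multiplication on `H`. -/
def lmH : H →ₐ[k] Module.End k H := lm (AlgHom.id k H)

variable (Q) in
/-- The operators `m ↦ m S(x)` on `H`. -/
def rmH : H →ₐ[k] Module.End k H := rm (Q.anti (AlgHom.id k H))

@[simp]
theorem lmH_apply (x m : H) : lmH k H x m = x * m := rfl

@[simp]
theorem rmH_apply (x m : H) : Q.rmH x m = m * Q.S x := by simp [rmH]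

theorem com_lmH_rmH : Com (lmH k H) Q.rmH := com_lm_rm _ _

theorem inducedAction_tmul_aux (ρ : LeftAction k H V) (t : H ⊗[k] H) (z a : H) (v : V) :
    (Module.endTensorEndAlgHom (R := k) (S := k) (A := k) (M := H) (N := V))
      ((Algebra.TensorProduct.map (AlgHom.mulLeftRight k H) ρ)
        (((Algebra.TensorProduct.assoc k k k H Hᵐᵒᵖ H).symm.toAlgHom.comp
          ((Algebra.TensorProduct.congr AlgEquiv.refl
            (Algebra.TensorProduct.comm k H Hᵐᵒᵖ)).toAlgHom.comp
            (Algebra.TensorProduct.assoc k k k H H Hᵐᵒᵖ).toAlgHom))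
          (t ⊗ₜ Q.antipode z))) (a ⊗ₜ v) =
      ev2 (onL V (lmH k H)) (onR H ρ) t (onL V Q.rmH z (a ⊗ₜ v)) := by
  induction t with
  | zero => simp
  | add x y hx hy => simp only [map_add, TensorProduct.add_tmul, LinearMap.add_apply, hx, hy]
  | tmul x y => simp [Module.endTensorEndAlgHom_apply, mul_assoc, S]

theorem inducedAction_eq (ρ : LeftAction k H V) : Q.inducedAction ρ =
    Q.cv (Q.cv (onL V (lmH k H)) (onR H ρ)) (onL V Q.rmH) := by
  refine AlgHom.ext fun h => TensorProduct.ext' fun a v => ?_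
  have h12 : Com (onL V (lmH k H)) (onR H ρ) := com_onL_onR _ _
  rw [cv_apply (com_cv_left (com_onL com_lmH_rmH) (com_onL_onR _ _).symm), inducedAction,
    AlgHom.comp_apply, AlgHom.comp_apply, AlgHom.comp_apply,
    AlgHom.comp_apply (Algebra.TensorProduct.map Q.comul Q.antipode)]
  generalize Q.comul h = t
  induction t with
  | zero => simp
  | add x y hx hy => simp only [map_add, LinearMap.add_apply, hx, hy]
  | tmul x y =>
    rw [ev2_tmul, cv_apply h12, Module.End.mul_apply, ← inducedAction_tmul_aux]
    rfl

/-- The operator `m ⊗ n ⊗ v ↦ m t₁ ⊗ n t₂ ⊗ v`. -/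
def mulRightTwo (V : Type w) [AddCommGroup V] [Module k V] (t : H ⊗[k] H) :
    Module.End k (H ⊗[k] (H ⊗[k] V)) :=
  (TensorProduct.assoc k H H V).toLinearMap ∘ₗ
    TensorProduct.map (LinearMap.mulRight k t) LinearMap.id ∘ₗ
      (TensorProduct.assoc k H H V).symm.toLinearMap

theorem mulRightTwo_tmul (p q m n : H) (v : V) :
    mulRightTwo V (p ⊗ₜ[k] q) (m ⊗ₜ (n ⊗ₜ v)) = (m * p) ⊗ₜ ((n * q) ⊗ₜ v) := by
  simp [mulRightTwo]

theorem mulRightTwo_assoc (t s : H ⊗[k] H) (v : V) :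
    mulRightTwo V t (TensorProduct.assoc k H H V (s ⊗ₜ v)) =
      TensorProduct.assoc k H H V ((s * t) ⊗ₜ v) := by
  simp [mulRightTwo]

theorem mulRightTwo_add (s t : H ⊗[k] H) :
    mulRightTwo V (s + t) = mulRightTwo V s + mulRightTwo V t := by
  ext m n v
  simp [mulRightTwo, mul_add, TensorProduct.add_tmul]

theorem mulRightTwo_zero : mulRightTwo V (0 : H ⊗[k] H) = 0 := by
  ext m n v
  simp [mulRightTwo]

/-- The linear map sending `a ⊗ b ⊗ c ⊗ d ⊗ e` to the operator
`m ⊗ n ⊗ v ↦ a m e ⊗ b n d ⊗ c v`. -/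
def fiveAction (ρ : LeftAction k H V) :
    H ⊗[k] (H ⊗[k] (H ⊗[k] (H ⊗[k] H))) →ₗ[k] Module.End k (H ⊗[k] (H ⊗[k] V)) :=
  (TensorProduct.homTensorHomMap (RingHom.id k) H (H ⊗[k] V) H (H ⊗[k] V) ∘ₗ
    TensorProduct.map (sandwich k H)
      (TensorProduct.homTensorHomMap (RingHom.id k) H V H V ∘ₗ
        TensorProduct.map (sandwich k H) ρ.toLinearMap)) ∘ₗ (nestFive k H).toLinearMap

theorem fiveAction_tmul (ρ : LeftAction k H V) (a b c d e m n : H) (v : V) :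
    fiveAction ρ (a ⊗ₜ (b ⊗ₜ (c ⊗ₜ (d ⊗ₜ e)))) (m ⊗ₜ (n ⊗ₜ v)) =
      (a * m * e) ⊗ₜ ((b * n * d) ⊗ₜ ρ c v) := by
  simp [fiveAction]

set_option maxSynthPendingDepth 6 in
-- Arbitrary `t`, `X`, `P` stand for `f⁻¹`, `χ`, `φ`, so that all three can be reduced to pure
-- tensors. Legs four and five act by right multiplication, which is why the leftmost factor of `ω`
-- is the operator applied first.
theorem fiveAction_omega_aux (ρ : LeftAction k H V) (t : H ⊗[k] H)
    (X : H ⊗[k] (H ⊗[k] (H ⊗[k] H))) (P : H ⊗[k] (H ⊗[k] H)) :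
    fiveAction ρ ((1 : H) ⊗ₜ[k] ((1 : H) ⊗ₜ[k] ((1 : H) ⊗ₜ[k] (TensorProduct.comm k H H t))) *
      TensorProduct.map LinearMap.id
        (comulFst Q.comul (H ⊗[k] H) ∘ₗ
          TensorProduct.map LinearMap.id (TensorProduct.map Q.S Q.S)) X *
      TensorProduct.map LinearMap.id
        (TensorProduct.map LinearMap.id ((TensorProduct.mk k H (H ⊗[k] H)).flip 1)) P) =
    ev4 (onL (H ⊗[k] V) (lmH k H)) (Q.cv (onR H (onL V (lmH k H))) (onR H (onR H ρ)))
        (onR H (onL V Q.rmH)) (onL (H ⊗[k] V) Q.rmH) X *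
      ev3 (onL (H ⊗[k] V) (lmH k H)) (onR H (onL V (lmH k H))) (onR H (onR H ρ)) P *
      mulRightTwo V t := by
  have hc : Com (onR (V := H) (onL V (lmH k H))) (onR H (onR H ρ)) :=
    com_onR (com_onL_onR _ _)
  induction t with
  | zero => simp [mulRightTwo_zero]
  | add s t hs ht =>
    simp only [map_add, TensorProduct.tmul_add, add_mul, mulRightTwo_add, mul_add, hs, ht]
  | tmul p q =>
  induction X with
  | zero => simp
  | add s t hs ht => simp only [map_add, add_mul, mul_add, hs, ht]
  | tmul x X =>
  induction X with
  | zero => simp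
  | add s t hs ht => simp only [map_add, TensorProduct.tmul_add, add_mul, mul_add, hs, ht]
  | tmul y X =>
  induction X with
  | zero => simp
  | add s t hs ht => simp only [map_add, TensorProduct.tmul_add, add_mul, mul_add, hs, ht]
  | tmul z w =>
  induction P with
  | zero => simp
  | add s t hs ht => simp only [map_add, mul_add, add_mul, hs, ht]
  | tmul a P =>
  induction P with
  | zero => simp
  | add s t hs ht => simp only [map_add, TensorProduct.tmul_add, mul_add, add_mul, hs, ht]
  | tmul b c =>
  simp only [TensorProduct.map_tmul, LinearMap.comp_apply, comulFst, LinearMap.id_apply,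
    AlgHom.toLinearMap_apply, ev4_tmul, ev3_tmul, ev2_tmul, cv_apply hc,
    TensorProduct.comm_tmul, LinearMap.flip_apply, TensorProduct.mk_apply, LinearEquiv.coe_coe]
  generalize Q.comul y = s
  induction s with
  | zero => simp
  | add s t hs ht =>
    simp only [map_add, TensorProduct.add_tmul, TensorProduct.tmul_add, mul_add, add_mul, hs, ht]
  | tmul y₁ y₂ =>
  refine TensorProduct.ext' fun m n => ?_
  induction n with
  | zero => simp
  | add s t hs ht => simp only [map_add, TensorProduct.tmul_add, hs, ht]
  | tmul n v =>
  rw [Algebra.TensorProduct.one_def]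
  simp only [TensorProduct.assoc_tmul, Algebra.TensorProduct.tmul_mul_tmul, fiveAction_tmul,
    Module.End.mul_apply, mulRightTwo_tmul, onL_tmul, onR_tmul, ev2_tmul, lmH_apply, rmH_apply,
    one_mul, mul_one, map_mul, mul_assoc]

theorem pairwise_onL_onR {f g : H →ₐ[k] Module.End k V} (h : Com f g) :
    List.Pairwise (Com (B := Module.End k (H ⊗[k] V)))
      [onL V (lmH k H), onR H f, onR H g, onL V Q.rmH] :=
  pairwise_four_iff.mpr ⟨⟨com_onL_onR _ _, com_onL_onR _ _, com_onL com_lmH_rmH⟩,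
    ⟨com_onR h, (com_onL_onR _ _).symm⟩, (com_onL_onR _ _).symm⟩

theorem Omega_eq (ρ : LeftAction k H V) (y : H ⊗[k] (H ⊗[k] V)) : Q.Omega ρ y =
    ((Q.theta (onL (H ⊗[k] V) (lmH k H)) (Q.cv (onR H (onL V (lmH k H))) (onR H (onR H ρ)))
        (onR H (onL V Q.rmH)) (onL (H ⊗[k] V) Q.rmH))⁻¹ : (Module.End k _)ˣ).val
      ((Q.ph (onL (H ⊗[k] V) (lmH k H)) (onR H (onL V (lmH k H))) (onR H (onR H ρ))).val
        (mulRightTwo V Q.twistInv y)) := by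
  have h23 : Com (onL (W := V) (lmH k H)) (onR H ρ) := com_onL_onR _ _
  rw [coe_theta_inv, coe_ph (com_onL_onR _ _) (com_onL_onR _ _) (com_onR h23),
    ← Module.End.mul_apply, ← Module.End.mul_apply, ← fiveAction_omega_aux]
  · rfl
  · rw [cv_onR h23]
    exact pairwise_onL_onR
      (com_cv_left (com_onL com_lmH_rmH) (com_onL_onR _ _).symm)

end Induced

end QuasiHopfAlgebra

namespace QuasiHopfAlgebra

/-! ### Counits of the antipode and of the twist. -/

section CounitTwist

variable {k : Type u} {H : Type v} [Field k] [Ring H] [Algebra k H]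
variable {B : Type*} [Ring B] [Algebra k B] {Q : QuasiHopfAlgebra k H}

/-- Apply `ε` to the axiom for `α`, using `ε(α) = 1`. -/
theorem counit_S (h : H) : Q.counit (Q.S h) = Q.counit h := by
  have key : ∀ t, Q.counit (antiLeft Q.antipode Q.alpha t) = Q.counit (Q.S
      (TensorProduct.rid k H (TensorProduct.map LinearMap.id Q.counit.toLinearMap t))) := by
    intro t
    induction t with
    | zero => simp
    | add x y hx hy => simp only [map_add, hx, hy]
    | tmul x y => simp [Q.counit_alpha, S, mul_comm]
  have e := key (Q.comul h)
  rw [Q.antipode_alpha, Q.counit_right] at e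
  simpa [Q.counit_alpha] using e.symm

@[simp]
theorem anti_triv : Q.anti (Q.triv B) = Q.triv Bᵐᵒᵖ := by
  ext x
  refine MulOpposite.unop_injective ?_
  rw [unop_anti, triv_apply, triv_apply, counit_S]
  rfl

@[simp]
theorem lm_triv : lm (Q.triv B) = Q.triv (Module.End k B) := by
  ext x b
  rw [lm_apply, triv_apply, triv_end_apply, Algebra.smul_def]

@[simp]
theorem rm_triv : rm (Q.triv Bᵐᵒᵖ) = Q.triv (Module.End k B) := by
  ext x b
  rw [rm_apply, triv_apply, triv_end_apply, Algebra.smul_def, Algebra.commutes]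
  rfl

theorem theta_triv_outer {g h : H →ₐ[k] B} (c : Com g h) :
    Q.theta (Q.triv B) g h (Q.triv B) = 1 := by
  rw [theta, cv_triv_left, ph_triv_right c, ph_triv_left c, one_mul, inv_one]

theorem theta_triv_inner {f i : H →ₐ[k] B} (c : Com f i) :
    Q.theta f (Q.triv B) (Q.triv B) i = 1 := by
  rw [theta, cv_triv_right, ph_triv_mid c, ph_triv_mid (com_triv_right f), one_mul, inv_one]

theorem triv_beta : Q.triv B Q.beta = 1 := by
  rw [triv_apply, Q.counit_beta, map_one]

/-- By `gauge_unique`, since `1` has the same antipode property and the same product with `β`. -/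
theorem tw_triv_left (a : H →ₐ[k] B) : Q.tw (Q.triv B) a = 1 := by
  refine gauge_unique (Q := Q) (F := a) (G := Q.anti a) (fun x => ?_) (fun x => ?_) ?_
  · have e := tw_antipode (Q := Q) (com_triv_left (Q := Q) a) x
    rwa [anti_triv, cv_triv_left, cv_triv_right] at e
  · rw [mul_one, one_mul, unop_anti]
  · have e := tw_beta (Q := Q) (com_triv_left (Q := Q) a)
    rw [anti_triv, lm_triv, rm_triv, theta_triv_outer (com_lm_rm _ _), cv_triv_left,
      triv_beta, one_mul] at e
    rw [e, mul_one]
    rfl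

theorem tw_triv_right (a : H →ₐ[k] B) : Q.tw a (Q.triv B) = 1 := by
  refine gauge_unique (Q := Q) (F := a) (G := Q.anti a) (fun x => ?_) (fun x => ?_) ?_
  · have e := tw_antipode (Q := Q) (com_triv_right (Q := Q) a) x
    rwa [anti_triv, cv_triv_left, cv_triv_right] at e
  · rw [mul_one, one_mul, unop_anti]
  · have e := tw_beta (Q := Q) (com_triv_right (Q := Q) a)
    rw [anti_triv, lm_triv, rm_triv, theta_triv_inner (com_lm_rm _ _), cv_triv_right,
      triv_beta, mul_one] at e
    rw [e, mul_one]
    rfl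

end CounitTwist

/-! ### Pairing the last factor with an invariant form. -/

section PairRight

variable {k : Type u} {H : Type v} [Field k] [Ring H] [Algebra k H]
variable {Q : QuasiHopfAlgebra k H}
variable {V : Type w} [AddCommGroup V] [Module k V]
variable {W : Type*} [AddCommGroup W] [Module k W] {W' : Type*} [AddCommGroup W'] [Module k W']

variable (H) in
/-- The linear map `m ⊗ v ↦ ξ(v) m`. -/
def pairRight (ξ : V →ₗ[k] k) : H ⊗[k] V →ₗ[k] H :=
  (TensorProduct.rid k H).toLinearMap ∘ₗ TensorProduct.map LinearMap.id ξ

@[simp]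
theorem pairRight_tmul (ξ : V →ₗ[k] k) (m : H) (v : V) : pairRight H ξ (m ⊗ₜ v) = ξ v • m := by
  simp [pairRight]

theorem pairRight_onL (ξ : V →ₗ[k] k) (f : H →ₐ[k] Module.End k H) :
    Intertwines (pairRight H ξ) (onL V f) f := fun x t => by
  induction t with
  | zero => simp
  | add s t hs ht => simp only [map_add, hs, ht]
  | tmul m v => simp

theorem pairRight_onR {ξ : V →ₗ[k] k} {ρ : H →ₐ[k] Module.End k V}
    (hξ : ∀ h v, ξ (ρ h v) = Q.counit h • ξ v) :
    Intertwines (pairRight H ξ) (onR H ρ) (Q.triv _) := fun x t => by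
  induction t with
  | zero => simp
  | add s t hs ht => simp only [map_add, hs, ht]
  | tmul m v => simp [hξ, triv_end_apply, mul_smul, smul_comm (ξ v)]

theorem map_id_onL (σ : W →ₗ[k] W') (f : H →ₐ[k] Module.End k V) :
    Intertwines (TensorProduct.map (LinearMap.id : V →ₗ[k] V) σ) (onL W f) (onL W' f) :=
  fun x t => by
    induction t with
    | zero => simp
    | add s t hs ht => simp only [map_add, hs, ht]
    | tmul m v => simp

theorem map_id_onR {σ : W →ₗ[k] W'} {f : H →ₐ[k] Module.End k W} {f' : H →ₐ[k] Module.End k W'}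
    (h : Intertwines σ f f') :
    Intertwines (TensorProduct.map (LinearMap.id : V →ₗ[k] V) σ) (onR V f) (onR V f') :=
  fun x t => by
    induction t with
    | zero => simp
    | add s t hs ht => simp only [map_add, hs, ht]
    | tmul m v => simp [h x v]

@[simp]
theorem onR_triv : onR V (Q.triv (Module.End k W)) = Q.triv _ :=
  AlgHom.ext fun x => TensorProduct.ext' fun m n => by simp [triv_end_apply]

variable (Q) in
/-- The operator on `H ⊗ H` by which `(φ ⊗ 1) (Δ ⊗ id ⊗ id)(φ⁻¹)` acts via
`x ⊗ y ⊗ z ⊗ w ↦ (m ⊗ n ↦ x m S(w) ⊗ y n S(z))`. -/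
def chiOp : (Module.End k (H ⊗[k] H))ˣ :=
  (Q.theta (onL H (lmH k H)) (onR H (lmH k H)) (onR H Q.rmH) (onL H Q.rmH))⁻¹

/-- Invariance of `ξ` makes the module leg trivial, so the factor `φ` of `ω` disappears and `theta`
loses that leg. With `ξ = id` on `k` this computes the coaction of `A`; with `ξ` a class function it
yields colinearity of `coactEnd ξ`. -/
theorem map_pairRight_Omega {ρ : LeftAction k H V} {ξ : V →ₗ[k] k}
    (hξ : ∀ h v, ξ (ρ h v) = Q.counit h • ξ v) (z : H ⊗[k] V) :
    TensorProduct.map LinearMap.id (pairRight H ξ) (Q.Omega ρ (comulFst Q.comul V z)) =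
      Q.chiOp.val (Q.comul (pairRight H ξ z) * Q.twistInv) := by
  have h23 : Com (onL (W := V) (lmH k H)) (onR H ρ) := com_onL_onR _ _
  have i₁ := map_id_onL (V := H) (pairRight H ξ) (lmH k H)
  have i₂ := map_id_onR (V := H) (pairRight_onL ξ (lmH k H))
  have i₃ := map_id_onR (V := H) (pairRight_onR hξ)
  have i₅ := map_id_onR (V := H) (pairRight_onL ξ Q.rmH)
  have i₆ := map_id_onL (V := H) (pairRight H ξ) Q.rmH
  rw [onR_triv] at i₃
  have c₁ : List.Pairwise (Com (B := Module.End k (H ⊗[k] (H ⊗[k] V))))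
      [onL (H ⊗[k] V) (lmH k H), Q.cv (onR H (onL V (lmH k H))) (onR H (onR H ρ)),
        onR H (onL V Q.rmH), onL (H ⊗[k] V) Q.rmH] := by
    rw [cv_onR h23]
    exact pairwise_onL_onR (com_cv_left (com_onL com_lmH_rmH) (com_onL_onR _ _).symm)
  have c₂ : List.Pairwise (Com (B := Module.End k (H ⊗[k] H)))
      [onL H (lmH k H), Q.cv (onR H (lmH k H)) (Q.triv _), onR H Q.rmH, onL H Q.rmH] := by
    rw [cv_triv_right]
    exact pairwise_onL_onR com_lmH_rmH
  rw [Omega_eq, intertwines_inv (intertwines_theta c₁ c₂ i₁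
      (intertwines_cv (com_onR h23) (com_triv_right _) i₂ i₃) i₅ i₆),
    intertwines_ph ⟨com_onL_onR _ _, com_onL_onR _ _, com_onR h23⟩
      ⟨com_onL_onR _ _, com_triv_right _, com_triv_right _⟩ i₁ i₂ i₃,
    cv_triv_right, ph_triv_right (com_onL_onR _ _), chiOp, Units.val_one, Module.End.one_apply]
  congr 1
  induction z with
  | zero => simp
  | add x y hx hy => simp only [map_add, add_mul, hx, hy]
  | tmul m v =>
    have key : ∀ s : H ⊗[k] H, TensorProduct.map LinearMap.id (pairRight H ξ)
        (TensorProduct.assoc k H H V (s ⊗ₜ v)) = ξ v • s := by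
      intro s
      induction s with
      | zero => simp
      | add x y hx hy => simp only [map_add, smul_add, TensorProduct.add_tmul, hx, hy]
      | tmul x y => simp
    simp only [comulFst, LinearMap.comp_apply, TensorProduct.map_tmul, LinearMap.id_apply,
      LinearEquiv.coe_coe, mulRightTwo_assoc, key, pairRight_tmul, map_smul,
      AlgHom.toLinearMap_apply, smul_mul_assoc]

theorem pairRight_inducedAction {ρ : LeftAction k H V} {ξ : V →ₗ[k] k}
    (hξ : ∀ h v, ξ (ρ h v) = Q.counit h • ξ v) (h : H) (z : H ⊗[k] V) :
    pairRight H ξ (Q.inducedAction ρ h z) = Q.cv (lmH k H) Q.rmH h (pairRight H ξ z) := by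
  have h12 : Com (onL (W := V) (lmH k H)) (onR H ρ) := com_onL_onR _ _
  have e := intertwines_cv (Q := Q)
    (com_cv_left (com_onL com_lmH_rmH) (com_onL_onR _ _).symm)
    (com_cv_left com_lmH_rmH (com_triv_left _))
    (intertwines_cv (Q := Q) h12 (com_triv_right _) (pairRight_onL ξ (lmH k H)) (pairRight_onR hξ))
    (pairRight_onL ξ Q.rmH) h z
  rwa [cv_triv_right, ← inducedAction_eq] at e

theorem rid_eq_pairRight : (TensorProduct.rid k H).toLinearMap = pairRight H LinearMap.id := by
  ext x
  simp

theorem adAction_eq : Q.adAction = Q.cv (lmH k H) Q.rmH := by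
  ext h a
  have e := pairRight_inducedAction (Q := Q) (ρ := Q.trivialAction) (ξ := LinearMap.id)
    (fun _ _ => rfl) h (a ⊗ₜ 1)
  simp only [← rid_eq_pairRight, LinearEquiv.coe_coe, TensorProduct.rid_tmul, one_smul] at e
  exact e

theorem adCoaction_apply (a : H) :
    Q.adCoaction a = Q.chiOp.val (Q.comul a * Q.twistInv) := by
  have e := map_pairRight_Omega (Q := Q) (ρ := Q.trivialAction) (ξ := LinearMap.id)
    (fun _ _ => rfl) (a ⊗ₜ 1)
  simp only [← rid_eq_pairRight, LinearEquiv.coe_coe, TensorProduct.rid_tmul, one_smul] at e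
  exact e

end PairRight

end QuasiHopfAlgebra

namespace QuasiHopfAlgebra

/-! ### Equivariance and counits of the coaction of `A`. -/

section Coaction

variable {k : Type u} {H : Type v} [Field k] [Ring H] [Algebra k H]
variable {Q : QuasiHopfAlgebra k H}

variable (Q) in
/-- The linear map `a ↦ Δ(a) f⁻¹`. -/
def twistedComul : H →ₗ[k] H ⊗[k] H :=
  LinearMap.mulRight k Q.twistInv ∘ₗ Q.comul.toLinearMap

theorem twistedComul_apply (a : H) : Q.twistedComul a = Q.comul a * Q.twistInv := rfl

theorem ev2_onL_onR_lmH (t s : H ⊗[k] H) : ev2 (onL H (lmH k H)) (onR H (lmH k H)) t s = t * s := by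
  induction t with
  | zero => simp
  | add x y hx hy => simp only [map_add, LinearMap.add_apply, add_mul, hx, hy]
  | tmul x y =>
    induction s with
    | zero => simp
    | add x y hx hy => simp only [map_add, mul_add, hx, hy]
    | tmul z w => simp

theorem ev2_onR_onL_rmH (t s : H ⊗[k] H) : ev2 (onR H Q.rmH) (onL H Q.rmH) t s =
    s * TensorProduct.map Q.S Q.S (TensorProduct.comm k H H t) := by
  induction t with
  | zero => simp
  | add x y hx hy => simp only [map_add, LinearMap.add_apply, mul_add, hx, hy]
  | tmul x y =>
    induction s with
    | zero => simp
    | add x y hx hy => simp only [map_add, add_mul, hx, hy]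
    | tmul z w => simp

theorem twistedComul_lmH : Intertwines Q.twistedComul (lmH k H)
    (Q.cv (onL H (lmH k H)) (onR H (lmH k H))) := fun x a => by
  rw [cv_apply (com_onL_onR _ _), ev2_onL_onR_lmH, twistedComul_apply, twistedComul_apply,
    lmH_apply, map_mul, mul_assoc]

theorem comul_S (x : H) : Q.comul (Q.S x) * Q.twistInv = Q.twistInv * Q.antipodeCop x := by
  have e := tw_antipode (Q := Q) com_include x
  rwa [tw, cv_include, unop_cv_anti com_include, ev2_include, ev2_include] at e

/-- This is the purpose of the twist: it turns `Δ(S(x))` into `S(x₍₂₎) ⊗ S(x₍₁₎)`. -/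
theorem twistedComul_rmH : Intertwines Q.twistedComul Q.rmH
    (Q.cv (onR H Q.rmH) (onL H Q.rmH)) := fun x a => by
  rw [cv_apply (com_onL_onR _ _).symm, ev2_onR_onL_rmH, twistedComul_apply, twistedComul_apply,
    rmH_apply, map_mul, mul_assoc, comul_S, mul_assoc]
  rfl

theorem pairwise_chi : List.Pairwise (Com (B := Module.End k (H ⊗[k] H)))
    [onL H (lmH k H), onR H (lmH k H), onR H Q.rmH, onL H Q.rmH] :=
  pairwise_onL_onR com_lmH_rmH

theorem adCoaction_eq : Q.adCoaction = Q.chiOp.val ∘ₗ Q.twistedComul :=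
  LinearMap.ext adCoaction_apply

/-- `twistedComul` carries the adjoint action to the legs bracketed as `(fg)(hi)`; by
`theta_semiconj`, `χ` rebrackets them to `(f(gh))i`, where `gh` is the adjoint action on the second
factor. -/
theorem adCoaction_adAction (h a : H) :
    Q.adCoaction (Q.adAction h a) = Q.inducedAction Q.adAction h (Q.adCoaction a) := by
  have h₃ : Com (Q.cv (onL H (lmH k H)) (onR H (lmH k H))) (Q.cv (onR H Q.rmH) (onL H Q.rmH)) :=
    com_cv_left (com_cv_right (com_onL_onR _ _) (com_onL com_lmH_rmH))
      (com_cv_right (com_onR com_lmH_rmH) (com_onL_onR _ _).symm)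
  have e := intertwines_cv (Q := Q) com_lmH_rmH h₃ twistedComul_lmH twistedComul_rmH h a
  have s := (theta_semiconj (Q := Q) (pairwise_chi (Q := Q)) h).units_inv_symm_left.eq
  rw [adAction_eq, adCoaction_eq, LinearMap.comp_apply, LinearMap.comp_apply, e,
    ← Module.End.mul_apply, chiOp, s, inducedAction_eq, cv_onR com_lmH_rmH]
  rfl

theorem counit_adCoaction (a : H) : TensorProduct.lid k H
    (TensorProduct.map Q.counit.toLinearMap LinearMap.id (Q.adCoaction a)) = a := by
  have key : (TensorProduct.lid k H).toLinearMap ∘ₗ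
      TensorProduct.map Q.counit.toLinearMap LinearMap.id = ev2 (Q.triv H) (AlgHom.id k H) := by
    ext x y
    simp [triv_apply, Algebra.smul_def]
  have i₁ : Intertwines (ev2 (Q.triv H) (AlgHom.id k H)) (onL H (lmH k H)) (Q.triv _) :=
    fun x t => by
      induction t with
      | zero => simp
      | add x y hx hy => simp only [map_add, hx, hy]
      | tmul x y => simp [triv_apply, Algebra.smul_def, mul_assoc]
  have i₂ : Intertwines (ev2 (Q.triv H) (AlgHom.id k H)) (onR H (lmH k H)) (lmH k H) :=
    fun x t => by
      induction t with
      | zero => simp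
      | add x y hx hy => simp only [map_add, hx, hy]
      | tmul y z =>
        simp only [onR_tmul, ev2_tmul, lmH_apply, AlgHom.id_apply, ← mul_assoc,
          (commute_triv x y).eq]
  have i₃ : Intertwines (ev2 (Q.triv H) (AlgHom.id k H)) (onR H Q.rmH) Q.rmH :=
    fun x t => by
      induction t with
      | zero => simp
      | add x y hx hy => simp only [map_add, hx, hy]
      | tmul y z => simp [mul_assoc]
  have i₄ : Intertwines (ev2 (Q.triv H) (AlgHom.id k H)) (onL H Q.rmH) (Q.triv _) :=
    fun x t => by
      induction t with
      | zero => simp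
      | add x y hx hy => simp only [map_add, hx, hy]
      | tmul y z =>
        have e : Q.counit (y * Q.S x) = Q.counit x * Q.counit y := by
          rw [map_mul, counit_S, mul_comm]
        rw [onL_tmul, ev2_tmul, ev2_tmul, rmH_apply, triv_end_apply, triv_apply, triv_apply, e,
          map_mul, mul_assoc, Algebra.smul_def]
  change ((TensorProduct.lid k H).toLinearMap ∘ₗ
      TensorProduct.map Q.counit.toLinearMap LinearMap.id) _ = a
  rw [key, adCoaction_apply, chiOp, intertwines_inv (intertwines_theta (pairwise_chi (Q := Q))
    (pairwise_four_iff.mpr ⟨⟨com_triv_left _, com_triv_left _, com_triv_left _⟩,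
      ⟨com_lmH_rmH, com_triv_right _⟩, com_triv_right _⟩) i₁ i₂ i₃ i₄),
    theta_triv_outer com_lmH_rmH, ev2_mul (com_triv_left _), ← cv_apply (com_triv_left _),
    cv_triv_left]
  have e := tw_triv_left (Q := Q) (AlgHom.id k H)
  rw [tw] at e
  rw [e]
  simp

/-- With `ε` in the second factor the inner legs become trivial, so `theta` becomes `1` and the
twist is removed by `tw_triv_right`. This second counit property, specific to `A`, makes `ε` the
unit of the class functions. -/
theorem pairRight_counit_adCoaction (a : H) :
    pairRight H Q.counit.toLinearMap (Q.adCoaction a) = a := by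
  have key : pairRight H Q.counit.toLinearMap = ev2 (AlgHom.id k H) (Q.triv H) := by
    ext x y
    simp [triv_apply, Algebra.smul_def, Algebra.commutes]
  have i₂ : Intertwines (pairRight H Q.counit.toLinearMap) (onR H (lmH k H)) (Q.triv _) :=
    pairRight_onR fun x y => by simp
  have i₃ : Intertwines (pairRight H Q.counit.toLinearMap) (onR H Q.rmH) (Q.triv _) :=
    pairRight_onR fun x y => by simp [counit_S, mul_comm]
  rw [adCoaction_apply, chiOp, intertwines_inv (intertwines_theta (pairwise_chi (Q := Q))
    (pairwise_four_iff.mpr ⟨⟨com_triv_right _, com_triv_right _, com_lmH_rmH⟩,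
      ⟨com_triv_left _, com_triv_left _⟩, com_triv_left _⟩)
      (pairRight_onL _ _) i₂ i₃ (pairRight_onL _ _)),
    theta_triv_inner com_lmH_rmH, key, ev2_mul (com_triv_right _), ← cv_apply (com_triv_right _),
    cv_triv_right]
  have e := tw_triv_right (Q := Q) (AlgHom.id k H)
  rw [tw] at e
  rw [e]
  simp

end Coaction

/-! ### The iterated twisted comultiplication in `H ⊗ H ⊗ H`. -/

section Coassociativity

variable {k : Type u} {H : Type v} [Field k] [Ring H] [Algebra k H]
variable {Q : QuasiHopfAlgebra k H}

variable (k H) in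
/-- The algebra map `x ↦ x ⊗ 1 ⊗ 1`. -/
def incl₁ : H →ₐ[k] H ⊗[k] (H ⊗[k] H) := Algebra.TensorProduct.includeLeft

variable (k H) in
/-- The algebra map `x ↦ 1 ⊗ x ⊗ 1`. -/
def incl₂ : H →ₐ[k] H ⊗[k] (H ⊗[k] H) :=
  Algebra.TensorProduct.includeRight.comp Algebra.TensorProduct.includeLeft

variable (k H) in
/-- The algebra map `x ↦ 1 ⊗ 1 ⊗ x`. -/
def incl₃ : H →ₐ[k] H ⊗[k] (H ⊗[k] H) :=
  Algebra.TensorProduct.includeRight.comp Algebra.TensorProduct.includeRight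

theorem incl₁_apply (x : H) : incl₁ k H x = x ⊗ₜ (1 ⊗ₜ 1) := rfl

theorem incl₂_apply (x : H) : incl₂ k H x = 1 ⊗ₜ (x ⊗ₜ 1) := rfl

theorem incl₃_apply (x : H) : incl₃ k H x = 1 ⊗ₜ (1 ⊗ₜ x) := rfl

theorem com3_incl : Com3 (incl₁ k H) (incl₂ k H) (incl₃ k H) := by
  constructor <;> intro x y <;>
    simp [Commute, SemiconjBy, incl₁_apply, incl₂_apply, incl₃_apply]

/-- This and the next five lemmas identify the operators occurring in `ω` with multiplications in
the algebra `H ⊗ H ⊗ H`, where `tw_coherence` and `theta_coherence` apply. -/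
theorem lm_incl₁ : lm (incl₁ k H) = onL (H ⊗[k] H) (lmH k H) := by
  ext x a b c
  simp [incl₁_apply]

theorem lm_incl₂ : lm (incl₂ k H) = onR H (onL H (lmH k H)) := by
  ext x a b c
  simp [incl₂_apply]

theorem lm_incl₃ : lm (incl₃ k H) = onR H (onR H (lmH k H)) := by
  ext x a b c
  simp [incl₃_apply]

theorem rm_incl₁ : rm (Q.anti (incl₁ k H)) = onL (H ⊗[k] H) Q.rmH := by
  ext x a b c
  simp [incl₁_apply]

theorem rm_incl₂ : rm (Q.anti (incl₂ k H)) = onR H (onL H Q.rmH) := by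
  ext x a b c
  simp [incl₂_apply]

theorem rm_incl₃ : rm (Q.anti (incl₃ k H)) = onR H (onR H Q.rmH) := by
  ext x a b c
  simp [incl₃_apply]

theorem tw_incl₂₃ : Q.tw (incl₂ k H) (incl₃ k H) = 1 ⊗ₜ Q.twistInv := by
  rw [tw]
  generalize Q.twistInv = t
  induction t with
  | zero => simp
  | add x y hx hy => simp only [map_add, TensorProduct.tmul_add, hx, hy]
  | tmul x y => simp [incl₂_apply, incl₃_apply]

theorem map_twistedComul (t : H ⊗[k] H) :
    TensorProduct.map LinearMap.id Q.twistedComul t =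
      ev2 (incl₁ k H) (Q.cv (incl₂ k H) (incl₃ k H)) t * Q.tw (incl₂ k H) (incl₃ k H) := by
  induction t with
  | zero => simp
  | add x y hx hy => simp only [map_add, add_mul, hx, hy]
  | tmul x y =>
    rw [tw_incl₂₃, TensorProduct.map_tmul, twistedComul_apply, ev2_tmul, cv_apply com3_incl.3,
      LinearMap.id_apply]
    generalize Q.comul y = s
    induction s with
    | zero => simp
    | add x y hx hy => simp only [map_add, mul_add, add_mul, TensorProduct.tmul_add, hx, hy]
    | tmul y z => simp [incl₁_apply, incl₂_apply, incl₃_apply]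

theorem mulRightTwo_comulFst (t : H ⊗[k] H) :
    mulRightTwo H Q.twistInv (comulFst Q.comul H t) =
      ev2 (Q.cv (incl₁ k H) (incl₂ k H)) (incl₃ k H) t * Q.tw (incl₁ k H) (incl₂ k H) := by
  induction t with
  | zero => simp
  | add x y hx hy => simp only [map_add, add_mul, hx, hy]
  | tmul x y =>
    rw [ev2_tmul, cv_apply com3_incl.1, comulFst, tw]
    simp only [LinearMap.comp_apply, TensorProduct.map_tmul, LinearMap.id_apply,
      LinearEquiv.coe_coe, mulRightTwo_assoc, AlgHom.toLinearMap_apply]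
    generalize Q.comul x = s
    generalize Q.twistInv = t
    induction s with
    | zero => simp
    | add x y hx hy => simp only [map_add, add_mul, TensorProduct.add_tmul, hx, hy]
    | tmul x z =>
      induction t with
      | zero => simp
      | add x y hx hy => simp only [map_add, mul_add, TensorProduct.add_tmul, hx, hy]
      | tmul p q => simp [incl₁_apply, incl₂_apply, incl₃_apply]

theorem map_twistedComul_twistedComul (a : H) :
    TensorProduct.map LinearMap.id Q.twistedComul (Q.twistedComul a) =
      Q.cv (incl₁ k H) (Q.cv (incl₂ k H) (incl₃ k H)) a *
        Q.tw (incl₁ k H) (Q.cv (incl₂ k H) (incl₃ k H)) * Q.tw (incl₂ k H) (incl₃ k H) := by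
  have c := com_cv_right (Q := Q) (com3_incl (k := k) (H := H)).1 com3_incl.2
  rw [map_twistedComul, twistedComul_apply, ev2_mul c, ← cv_apply c]
  rfl

theorem mulRightTwo_twistedComul (a : H) :
    mulRightTwo H Q.twistInv (comulFst Q.comul H (Q.twistedComul a)) =
      Q.cv (Q.cv (incl₁ k H) (incl₂ k H)) (incl₃ k H) a *
        Q.tw (Q.cv (incl₁ k H) (incl₂ k H)) (incl₃ k H) * Q.tw (incl₁ k H) (incl₂ k H) := by
  have c := com_cv_left (Q := Q) (com3_incl (k := k) (H := H)).2 com3_incl.3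
  rw [mulRightTwo_comulFst, twistedComul_apply, ev2_mul c, ← cv_apply c]
  rfl

end Coassociativity

end QuasiHopfAlgebra

namespace QuasiHopfAlgebra

/-! ### Coassociativity of the coaction of `A`. -/

section YetterDrinfeld

variable {k : Type u} {H : Type v} [Field k] [Ring H] [Algebra k H]
variable {Q : QuasiHopfAlgebra k H}

/-- Coassociativity of `a ↦ Δ(a) f⁻¹` up to `φ` on the left and its antipode image on the right:
quasi-coassociativity handles `a` and `tw_coherence` handles the twists. -/
theorem ph_mulRightTwo (a : H) :
    (Q.ph (B := Module.End k (H ⊗[k] (H ⊗[k] H)))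
        (lm (incl₁ k H)) (lm (incl₂ k H)) (lm (incl₃ k H))).val
        (mulRightTwo H Q.twistInv (comulFst Q.comul H (Q.twistedComul a))) =
      (Q.ph (B := Module.End k (H ⊗[k] (H ⊗[k] H)))
        (rm (Q.anti (incl₃ k H))) (rm (Q.anti (incl₂ k H))) (rm (Q.anti (incl₁ k H)))).val
        (TensorProduct.map LinearMap.id Q.twistedComul (Q.twistedComul a)) := by
  have c := com3_incl (k := k) (H := H)
  rw [ph_lm c, ph_rm ⟨com_anti c.3.symm, com_anti c.2.symm, com_anti c.1.symm⟩,
    mulRightTwo_twistedComul, map_twistedComul_twistedComul, ← mul_assoc, ← mul_assoc,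
    (ph_semiconj_cv c a).eq, mul_assoc _ (Q.tw (incl₁ k H) _), mul_assoc _ (_ * _), ← tw_coherence c]
  simp only [mul_assoc]

theorem map_adCoaction (t : H ⊗[k] H) :
    TensorProduct.map LinearMap.id Q.adCoaction t =
      ((Q.theta (onR H (onL H (lmH k H))) (onR H (onR H (lmH k H))) (onR H (onR H Q.rmH))
        (onR H (onL H Q.rmH)))⁻¹ : (Module.End k _)ˣ).val
        (TensorProduct.map LinearMap.id Q.twistedComul t) := by
  have c : List.Pairwise (Com (B := Module.End k (H ⊗[k] (H ⊗[k] H))))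
      [onR H (onL H (lmH k H)), onR H (onR H (lmH k H)), onR H (onR H Q.rmH),
        onR H (onL H Q.rmH)] := by
    obtain ⟨⟨h01, h02, h03⟩, ⟨h12, h13⟩, h23⟩ := pairwise_four_iff.mp (pairwise_chi (Q := Q))
    exact pairwise_four_iff.mpr ⟨⟨com_onR h01, com_onR h02, com_onR h03⟩,
      ⟨com_onR h12, com_onR h13⟩, com_onR h23⟩
  induction t with
  | zero => simp
  | add x y hx hy => simp only [map_add, hx, hy]
  | tmul m n =>
    rw [TensorProduct.map_tmul, TensorProduct.map_tmul, adCoaction_eq, LinearMap.comp_apply]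
    exact intertwines_inv (intertwines_theta (π := TensorProduct.mk k H (H ⊗[k] H) m)
      pairwise_chi c (fun _ _ => rfl) (fun _ _ => rfl) (fun _ _ => rfl) (fun _ _ => rfl)) _

theorem mulRightTwo_comulFst_onL_lmH :
    Intertwines (mulRightTwo H Q.twistInv ∘ₗ comulFst Q.comul H) (onL H (lmH k H))
      (Q.cv (B := Module.End k (H ⊗[k] (H ⊗[k] H)))
        (lm (incl₁ k H)) (lm (incl₂ k H))) := fun x t => by
  rw [cv_lm com3_incl.1, lm_apply, LinearMap.comp_apply, LinearMap.comp_apply,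
    mulRightTwo_comulFst, mulRightTwo_comulFst, ← mul_assoc]
  congr 1
  induction t with
  | zero => simp
  | add x y hx hy => simp only [map_add, mul_add, hx, hy]
  | tmul m n => simp [mul_assoc]

theorem mulRightTwo_comulFst_onR_lmH :
    Intertwines (mulRightTwo H Q.twistInv ∘ₗ comulFst Q.comul H) (onR H (lmH k H))
      (lm (incl₃ k H)) := fun x t => by
  have c := com_cv_left (Q := Q) (com3_incl (k := k) (H := H)).2 com3_incl.3
  rw [lm_apply, LinearMap.comp_apply, LinearMap.comp_apply,
    mulRightTwo_comulFst, mulRightTwo_comulFst, ← mul_assoc]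
  congr 1
  induction t with
  | zero => simp
  | add x y hx hy => simp only [map_add, mul_add, hx, hy]
  | tmul m n =>
    rw [onR_tmul, lmH_apply, ev2_tmul, ev2_tmul, map_mul, ← mul_assoc, ← mul_assoc, (c m x).eq]

theorem mulRightTwo_comulFst_onR_rmH :
    Intertwines (mulRightTwo H Q.twistInv ∘ₗ comulFst Q.comul H) (onR H Q.rmH)
      (rm (Q.anti (incl₃ k H))) := fun x t => by
  have c := com3_incl (k := k) (H := H)
  rw [rm_apply, LinearMap.comp_apply, LinearMap.comp_apply, mulRightTwo_comulFst,
    mulRightTwo_comulFst, unop_anti, mul_assoc,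
    ← (commute_tw (Q := Q) (c.2.symm (Q.S x)) (c.3.symm (Q.S x))).eq, ← mul_assoc]
  congr 1
  induction t with
  | zero => simp
  | add x y hx hy => simp only [map_add, add_mul, hx, hy]
  | tmul m n => simp [mul_assoc]

theorem mulRightTwo_comulFst_onL_rmH :
    Intertwines (mulRightTwo H Q.twistInv ∘ₗ comulFst Q.comul H) (onL H Q.rmH)
      (Q.cv (B := Module.End k (H ⊗[k] (H ⊗[k] H)))
        (rm (Q.anti (incl₂ k H))) (rm (Q.anti (incl₁ k H)))) := fun x t => by
  have c := com_cv_left (Q := Q) (com3_incl (k := k) (H := H)).2 com3_incl.3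
  rw [cv_rm (com_anti com3_incl.1.symm), rm_apply, LinearMap.comp_apply, LinearMap.comp_apply,
    mulRightTwo_comulFst, mulRightTwo_comulFst, mul_assoc, ← tw_antipode com3_incl.1, ← mul_assoc]
  congr 1
  induction t with
  | zero => simp
  | add x y hx hy => simp only [map_add, add_mul, hx, hy]
  | tmul m n =>
    rw [onL_tmul, rmH_apply, ev2_tmul, ev2_tmul, map_mul, mul_assoc, mul_assoc, (c _ n).eq]

/-- `theta_coherence` solved for the two inverse thetas that occur in `(id ⊗ δ)δ`. -/
theorem coherence_inv_group {G : Type*} [Group G] {p t q s r u v : G}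
    (h : p * t * q⁻¹ * s = r * u * v) : v⁻¹ * u⁻¹ = s⁻¹ * q * t⁻¹ * (p⁻¹ * r) := by
  have hr : r = p * t * q⁻¹ * s * v⁻¹ * u⁻¹ := by rw [h]; group
  rw [hr]
  group

theorem pairwise_double_inner {B : Type*} [Ring B] [Algebra k B] {f₀ f₁ f₂ f₃ f₄ f₅ : H →ₐ[k] B}
    (hf : [f₀, f₁, f₂, f₃, f₄, f₅].Pairwise Com) :
    [f₀, Q.cv f₁ f₂, Q.cv f₃ f₄, f₅].Pairwise Com := by
  simp only [List.pairwise_cons, List.mem_cons, List.not_mem_nil, or_false, forall_eq_or_imp,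
    forall_eq, IsEmpty.forall_iff, implies_true, List.Pairwise.nil, and_true] at hf
  obtain ⟨⟨h01, h02, h03, h04, h05⟩, ⟨h12, h13, h14, h15⟩, ⟨h23, h24, h25⟩, ⟨h34, h35⟩, h45⟩ := hf
  refine pairwise_four_iff.mpr ⟨⟨?_, ?_, ?_⟩, ⟨?_, ?_⟩, ?_⟩ <;>
    apply_rules [com_cv_left, com_cv_right]

theorem pairwise_double_outer {B : Type*} [Ring B] [Algebra k B] {f₀ f₁ f₂ f₃ f₄ f₅ : H →ₐ[k] B}
    (hf : [f₀, f₁, f₂, f₃, f₄, f₅].Pairwise Com) :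
    [Q.cv f₀ f₁, f₂, f₃, Q.cv f₄ f₅].Pairwise Com := by
  simp only [List.pairwise_cons, List.mem_cons, List.not_mem_nil, or_false, forall_eq_or_imp,
    forall_eq, IsEmpty.forall_iff, implies_true, List.Pairwise.nil, and_true] at hf
  obtain ⟨⟨h01, h02, h03, h04, h05⟩, ⟨h12, h13, h14, h15⟩, ⟨h23, h24, h25⟩, ⟨h34, h35⟩, h45⟩ := hf
  refine pairwise_four_iff.mpr ⟨⟨?_, ?_, ?_⟩, ⟨?_, ?_⟩, ?_⟩ <;>
    apply_rules [com_cv_left, com_cv_right]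

/-- `id ⊗ twistedComul` doubles the two inner legs of `theta`; in `mulRightTwo_comulFst_chiOp` the
outer legs are doubled instead. -/
theorem map_twistedComul_chiOp (z : H ⊗[k] H) :
    TensorProduct.map LinearMap.id Q.twistedComul (Q.chiOp.val z) =
    ((Q.theta (B := Module.End k (H ⊗[k] (H ⊗[k] H)))
      (lm (incl₁ k H))
      (Q.cv (B := Module.End k (H ⊗[k] (H ⊗[k] H))) (lm (incl₂ k H)) (lm (incl₃ k H)))
      (Q.cv (B := Module.End k (H ⊗[k] (H ⊗[k] H)))
        (rm (Q.anti (incl₃ k H))) (rm (Q.anti (incl₂ k H)))) (rm (Q.anti (incl₁ k H))))⁻¹ :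
        (Module.End k _)ˣ).val (TensorProduct.map LinearMap.id Q.twistedComul z) := by
  refine intertwines_inv (intertwines_theta pairwise_chi ?_ ?_ ?_ ?_ ?_) z
  · exact pairwise_double_inner (pairwise_six com3_incl)
  · rw [lm_incl₁]
    exact map_id_onL _ _
  · rw [lm_incl₂, lm_incl₃, cv_onR (com_onL_onR _ _)]
    exact map_id_onR twistedComul_lmH
  · rw [rm_incl₂, rm_incl₃, cv_onR (com_onL_onR _ _).symm]
    exact map_id_onR twistedComul_rmH
  · rw [rm_incl₁]
    exact map_id_onL _ _

theorem mulRightTwo_comulFst_chiOp (z : H ⊗[k] H) :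
    (mulRightTwo H Q.twistInv ∘ₗ comulFst Q.comul H) (Q.chiOp.val z) =
    ((Q.theta (B := Module.End k (H ⊗[k] (H ⊗[k] H)))
      (Q.cv (B := Module.End k (H ⊗[k] (H ⊗[k] H))) (lm (incl₁ k H)) (lm (incl₂ k H)))
      (lm (incl₃ k H))
      (rm (Q.anti (incl₃ k H))) (Q.cv (B := Module.End k (H ⊗[k] (H ⊗[k] H)))
        (rm (Q.anti (incl₂ k H))) (rm (Q.anti (incl₁ k H)))))⁻¹ :
        (Module.End k _)ˣ).val ((mulRightTwo H Q.twistInv ∘ₗ comulFst Q.comul H) z) := by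
  refine intertwines_inv (intertwines_theta pairwise_chi ?_ mulRightTwo_comulFst_onL_lmH
    mulRightTwo_comulFst_onR_lmH mulRightTwo_comulFst_onR_rmH mulRightTwo_comulFst_onL_rmH) z
  exact pairwise_double_outer (pairwise_six com3_incl)

theorem adCoaction_coassoc (a : H) :
    TensorProduct.map LinearMap.id Q.adCoaction (Q.adCoaction a) =
      Q.Omega Q.adAction (comulFst Q.comul H (Q.adCoaction a)) := by
  have p := pairwise_six (Q := Q) (com3_incl (k := k) (H := H))
  have e := coherence_inv_group (theta_coherence (Q := Q) p)
  have e' := congrArg (fun q : (Module.End k (H ⊗[k] (H ⊗[k] H)))ˣ => q.val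
    (TensorProduct.map LinearMap.id Q.twistedComul (Q.twistedComul a))) e
  simp only [Units.val_mul, Module.End.mul_apply] at e'
  -- The associator of the antipode legs, applied to the iterated twisted comultiplication, is
  -- traded for the one of the left legs, which cancels against its inverse.
  rw [← ph_mulRightTwo, units_inv_apply rfl] at e'
  have hg : onR H (onR H Q.adAction) = Q.cv (B := Module.End k (H ⊗[k] (H ⊗[k] H)))
      (lm (incl₃ k H)) (rm (Q.anti (incl₃ k H))) := by
    rw [lm_incl₃, rm_incl₃, cv_onR (com_onR com_lmH_rmH), cv_onR com_lmH_rmH, adAction_eq]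
  rw [Omega_eq, hg, map_adCoaction, adCoaction_eq, LinearMap.comp_apply, map_twistedComul_chiOp,
    ← lm_incl₁, ← lm_incl₂, ← lm_incl₃, ← rm_incl₃, ← rm_incl₂, ← rm_incl₁, e']
  congr 2
  exact (mulRightTwo_comulFst_chiOp _).symm

theorem isYetterDrinfeld_ad : Q.IsYetterDrinfeld Q.adAction Q.adCoaction :=
  ⟨adCoaction_coassoc, counit_adCoaction, adCoaction_adAction⟩

end YetterDrinfeld

/-! ### Class functions and Yetter–Drinfeld endomorphisms. -/

section ClassFunctions

variable {k : Type u} {H : Type v} [Field k] [Ring H] [Algebra k H]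
variable {Q : QuasiHopfAlgebra k H}

theorem starElement_eq : Q.starElement = Q.adCoaction := by
  have key : ∀ t, (TensorProduct.homTensorHomMap (RingHom.id k) H H H H ∘ₗ
      TensorProduct.map (sandwich k H ∘ₗ TensorProduct.map LinearMap.id Q.S)
        (sandwich k H ∘ₗ TensorProduct.map LinearMap.id Q.S)) (outerInner k H t) =
      ev4 (onL H (lmH k H)) (onR H (lmH k H)) (onR H Q.rmH) (onL H Q.rmH) t := by
    intro t
    induction t with
    | zero => simp
    | add x y hx hy => simp only [map_add, hx, hy]
    | tmul x t =>
    induction t with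
    | zero => simp
    | add x y hx hy => simp only [map_add, TensorProduct.tmul_add, hx, hy]
    | tmul y t =>
    induction t with
    | zero => simp
    | add x y hx hy => simp only [map_add, TensorProduct.tmul_add, hx, hy]
    | tmul z w =>
    refine TensorProduct.ext' fun m n => ?_
    simp [mul_assoc]
  rw [adCoaction_eq, chiOp, coe_theta_inv (pairwise_chi (Q := Q)), starElement, key]
  rfl

theorem mem_classFunctions {ξ : H →ₗ[k] k} : ξ ∈ Q.classFunctions ↔
    ∀ h x, ξ (Q.adAction h x) = Q.counit h • ξ x := Iff.rfl

variable (Q) in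
/-- The endomorphism `a ↦ (id ⊗ ξ)(δ(a))` of the adjoint module. -/
def coactEnd (ξ : H →ₗ[k] k) : Module.End k H := pairRight H ξ ∘ₗ Q.adCoaction

theorem pairRight_comp {V : Type*} [AddCommGroup V] [Module k V] (ξ : V →ₗ[k] k)
    (g : Module.End k V) (t : H ⊗[k] V) :
    pairRight H (ξ ∘ₗ g) t = pairRight H ξ (TensorProduct.map LinearMap.id g t) := by
  induction t with
  | zero => simp
  | add x y hx hy => simp only [map_add, hx, hy]
  | tmul x y => simp

/-- Linearity is the equivariance of `δ` seen through the invariant form `ξ`. For colinearity, `id ⊗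
id ⊗ ξ` is applied to coassociativity: the `ω`-side collapses to `δ` of `coactEnd ξ v`. -/
theorem coactEnd_mem {ξ : H →ₗ[k] k} (hξ : ξ ∈ Q.classFunctions) :
    Q.coactEnd ξ ∈ endYD Q.adAction Q.adCoaction := by
  rw [mem_classFunctions] at hξ
  refine ⟨fun h v => ?_, fun v => ?_⟩
  · simp only [coactEnd, LinearMap.comp_apply]
    rw [adCoaction_adAction, pairRight_inducedAction hξ, ← adAction_eq]
  · have e := map_pairRight_Omega hξ (Q.adCoaction v)
    rw [← adCoaction_coassoc, ← adCoaction_apply] at e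
    rw [coactEnd, LinearMap.comp_apply, ← e, ← LinearMap.comp_apply (TensorProduct.map _ _),
      ← TensorProduct.map_comp]
    rfl

theorem counit_mem_classFunctions : Q.counit.toLinearMap ∈ Q.classFunctions := by
  rw [mem_classFunctions]
  intro h x
  have i₁ : Intertwines Q.counit.toLinearMap (lmH k H) (Q.triv _) := fun x y => by
    simp [triv_end_apply]
  have i₂ : Intertwines Q.counit.toLinearMap Q.rmH (Q.triv _) := fun x y => by
    simp [triv_end_apply, counit_S, mul_comm]
  have e := intertwines_cv (Q := Q) com_lmH_rmH (com_triv_left _) i₁ i₂ h x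
  rwa [cv_triv_left, ← adAction_eq, triv_end_apply] at e

theorem comp_mem_classFunctions {ξ : H →ₗ[k] k} (hξ : ξ ∈ Q.classFunctions) {g : Module.End k H}
    (hg : g ∈ endYD Q.adAction Q.adCoaction) : ξ ∘ₗ g ∈ Q.classFunctions := by
  rw [mem_classFunctions] at hξ ⊢
  intro h x
  rw [LinearMap.comp_apply, hg.1, hξ, LinearMap.comp_apply]

/-- Colinearity of `g` pulls it through `δ`. With `g = coactEnd ζ` this is multiplicativity, and
with `ξ = ε` it gives surjectivity. -/
theorem coactEnd_comp (ξ : H →ₗ[k] k) {g : Module.End k H}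
    (hg : g ∈ endYD Q.adAction Q.adCoaction) : Q.coactEnd (ξ ∘ₗ g) = Q.coactEnd ξ * g := by
  ext a
  rw [coactEnd, LinearMap.comp_apply, pairRight_comp, ← hg.2]
  rfl

theorem coactEnd_counit : Q.coactEnd Q.counit.toLinearMap = 1 :=
  LinearMap.ext pairRight_counit_adCoaction

theorem counit_comp_coactEnd (ξ : H →ₗ[k] k) : Q.counit.toLinearMap ∘ₗ Q.coactEnd ξ = ξ := by
  have key : ∀ t, Q.counit.toLinearMap (pairRight H ξ t) =
      ξ (TensorProduct.lid k H (TensorProduct.map Q.counit.toLinearMap LinearMap.id t)) := by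
    intro t
    induction t with
    | zero => simp
    | add x y hx hy => simp only [map_add, hx, hy]
    | tmul x y => simp [mul_comm]
  ext a
  rw [coactEnd, LinearMap.comp_apply, LinearMap.comp_apply, key, counit_adCoaction]

/-- Evaluating the second factor first presents `⋆` as precomposition by an endomorphism, with the
order of factors preserved. -/
theorem mul'_map_adCoaction (ξ ζ : H →ₗ[k] k) :
    LinearMap.mul' k k ∘ₗ TensorProduct.map ξ ζ ∘ₗ Q.adCoaction = ξ ∘ₗ Q.coactEnd ζ := by
  rw [coactEnd, ← LinearMap.comp_assoc, ← LinearMap.comp_assoc]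
  congr 1
  ext x y
  simp [mul_comm]

variable (Q) in
/-- The isomorphism `ξ ↦ (id ⊗ ξ) ∘ δ` from the class functions to the endomorphisms of the
adjoint Yetter-Drinfeld module. -/
def classFunctionsEquiv : Q.classFunctions ≃ₗ[k] endYD Q.adAction Q.adCoaction where
  toFun ξ := ⟨Q.coactEnd ξ, coactEnd_mem ξ.2⟩
  map_add' ξ ζ := Subtype.ext <| LinearMap.ext fun a => by
    simp [coactEnd, pairRight, TensorProduct.map_add_right]
  map_smul' c ξ := Subtype.ext <| LinearMap.ext fun a => by
    simp [coactEnd, pairRight, TensorProduct.map_smul_right]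
  invFun g := ⟨Q.counit.toLinearMap ∘ₗ (g : Module.End k H),
    comp_mem_classFunctions counit_mem_classFunctions g.2⟩
  left_inv ξ := Subtype.ext (counit_comp_coactEnd _)
  right_inv g := Subtype.ext <| by
    simp only [coactEnd_comp _ g.2, coactEnd_counit, one_mul]

variable (Q) in
/-- The product `ξ ⋆ ζ = (ξ ⊗ ζ) ∘ δ` of class functions. -/
def classFunctionsMul : Q.classFunctions →ₗ[k] Q.classFunctions →ₗ[k] Q.classFunctions :=
  LinearMap.mk₂ k (fun ξ ζ => ⟨ξ.1 ∘ₗ Q.coactEnd ζ, comp_mem_classFunctions ξ.2 (coactEnd_mem ζ.2)⟩)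
    (fun _ _ _ => rfl) (fun _ _ _ => rfl)
    (fun ξ ζ θ => Subtype.ext <| by
      have e : Q.coactEnd (ζ + θ : Q.classFunctions) = Q.coactEnd ζ + Q.coactEnd θ :=
        congrArg Subtype.val (map_add Q.classFunctionsEquiv ζ θ)
      simp only [e, LinearMap.comp_add]
      rfl)
    (fun c ξ ζ => Subtype.ext <| by
      have e : Q.coactEnd (c • ζ : Q.classFunctions) = c • Q.coactEnd ζ :=
        congrArg Subtype.val (map_smul Q.classFunctionsEquiv c ζ)
      simp only [e, LinearMap.comp_smul]
      rfl)

end ClassFunctions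

end QuasiHopfAlgebra

end

theorem mainTheorem11 {k H : Type*} [Field k] [Ring H] [Algebra k H]
    (Q : QuasiHopfAlgebra k H) (hS : Function.Bijective Q.antipode) :
    Q.IsYetterDrinfeld Q.adAction Q.adCoaction ∧
    ∃ μ : Q.classFunctions →ₗ[k] Q.classFunctions →ₗ[k] Q.classFunctions,
      (∀ ξ ζ : Q.classFunctions,
        (μ ξ ζ : H →ₗ[k] k) = Q.starProduct (ξ : H →ₗ[k] k) (ζ : H →ₗ[k] k)) ∧
      (∀ ξ ζ : Q.classFunctions,
        (μ ξ ζ : H →ₗ[k] k) =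
          LinearMap.mul' k k ∘ₗ
            TensorProduct.map (ξ : H →ₗ[k] k) (ζ : H →ₗ[k] k) ∘ₗ Q.adCoaction) ∧
      (∀ ξ ζ θ : Q.classFunctions, μ (μ ξ ζ) θ = μ ξ (μ ζ θ)) ∧
      ∃ e₁ : Q.classFunctions,
        (∀ ξ : Q.classFunctions, μ e₁ ξ = ξ ∧ μ ξ e₁ = ξ) ∧
        ∃ Ψ : Q.classFunctions ≃ₗ[k]
            QuasiHopfAlgebra.endYD Q.adAction Q.adCoaction,
          Ψ e₁ = 1 ∧
          ∀ ξ ζ : Q.classFunctions, Ψ (μ ξ ζ) = Ψ ξ * Ψ ζ := by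
  have hmul : ∀ ξ ζ : Q.classFunctions, (Q.classFunctionsMul ξ ζ : H →ₗ[k] k) =
      (ξ : H →ₗ[k] k) ∘ₗ Q.coactEnd ζ := fun _ _ => rfl
  have hcoact : ∀ ξ ζ : Q.classFunctions,
      Q.coactEnd (Q.classFunctionsMul ξ ζ) = Q.coactEnd ξ * Q.coactEnd ζ := fun ξ ζ =>
    QuasiHopfAlgebra.coactEnd_comp _ (QuasiHopfAlgebra.coactEnd_mem ζ.2)
  refine ⟨QuasiHopfAlgebra.isYetterDrinfeld_ad, Q.classFunctionsMul, fun ξ ζ => ?_,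
    fun ξ ζ => ?_, fun ξ ζ θ => ?_,
    ⟨Q.counit.toLinearMap, QuasiHopfAlgebra.counit_mem_classFunctions⟩, fun ξ => ⟨?_, ?_⟩,
    Q.classFunctionsEquiv, ?_, fun ξ ζ => ?_⟩
  · rw [QuasiHopfAlgebra.starProduct, QuasiHopfAlgebra.starElement_eq,
      QuasiHopfAlgebra.mul'_map_adCoaction, hmul]
  · rw [QuasiHopfAlgebra.mul'_map_adCoaction, hmul]
  -- Both sides are `ξ ∘ coactEnd ζ ∘ coactEnd θ`, so associativity is that of composition.
  · refine Subtype.ext ?_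
    rw [hmul, hmul, hmul, hcoact]
    rfl
  · exact Subtype.ext (QuasiHopfAlgebra.counit_comp_coactEnd _)
  · refine Subtype.ext ?_
    rw [hmul, QuasiHopfAlgebra.coactEnd_counit]
    rfl
  · exact Subtype.ext QuasiHopfAlgebra.coactEnd_counit
  · exact Subtype.ext (hcoact ξ ζ)
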